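/- Let $T$ be a locally compact Hausdorff space and let $\tau:T\to T$ be a local homeomorphism that is proper in the sense that inverse images of compact sets are compact ($\tau$ need not be surjective). Put $A=C_0(T)$. Let $\alpha:A\to A$ be the endomorphism $\alpha(f)=f\circ\tau$, and let $L:A\to A$ be the transfer operator $$L(f)(t)=\frac1{|\tau^{-1}(t)|}\sum_{\tau(s)=t}f(s),$$ with $L(f)(t)=0$ when $\tau^{-1}(t)=\emptyset$. *The Cuntz–Pimsner algebra.* Let $M_L$ be the Hilbert bimodule over $A$ obtained from a copy $\{q(m):m\in A\}$ of $A$, with $q(m)\cdot a=q(m\alpha(a))$, $a\cdot q(m)=q(am)$ and $\langle q(m),q(n)\rangle=L(m^*n)$, by factoring out the vectors of length zero and completing; let $\phi:A\to\mathcal L(M_L)$ be the left action. A Toeplitz representation of $M_L$ in a $C^*$-algebra $B$ is a pair of a linear map $\psi:M_L\to B$ and a homomorphism $\pi:A\to B$ with $\psi(x\cdot a)=\psi(x)\pi(a)$, $\psi(x)^*\psi(y)=\pi(\langle x,y\rangle)$ and $\psi(a\cdot x)=\pi(a)\psi(x)$; it induces a bounded linear map $(\psi,\pi)^{(1)}$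 on the compact operators $\mathcal K(M_L)=\overline{\operatorname{span}}\{\Theta_{x,y}:z\mapsto x\cdot\langle y,z\rangle\}$ with $(\psi,\pi)^{(1)}(\Theta_{x,y})=\psi(x)\psi(y)^*$. The Cuntz–Pimsner algebra $\mathcal O(M_L)$ is the $C^*$-algebra generated by a Toeplitz representation $(k_{M_L},k_A)$ that is universal among those with $(\psi,\pi)^{(1)}(\phi(a))=\pi(a)$ for all $a\in\phi^{-1}(\mathcal K(M_L))$. *The crossed product.* A Toeplitz-covariant representation of $(A,\alpha,L)$ in a $C^*$-algebra $B$ consists of a nondegenerate homomorphism $\pi:A\to B$ and an element $V$ of the multiplier algebra of $B$ such that $V\pi(a)=\pi(\alpha(a))V$ and $V^*\pi(a)V=\pi(L(a))$ for all $a\in A$. The Toeplitz crossed product $\mathcal T(A,\alpha,L)$ is the $C^*$-algebra generated by $i(A)\cup i(A)S$ for a universal Toeplitz-covariant representation $(i,S)$. A pair $(i(a),k)$ is a redundancy if $k\in\overline{i(A)SS^*i(A)}$ (closed linear span) and $i(a)i(b)S=k\,i(b)S$ for all $b\in A$. The crossed product $A\rtimes_{\alpha,L}\mathbb N$ is the quotient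 of $\mathcal T(A,\alpha,L)$ by the closed ideal generated by the elements $i(a)-k$ for all redundancies $(i(a),k)$ with $a\in\overline{A\alpha(A)A}$; let $Q$ be the quotient map. Then the canonical homomorphisms of $C_0(T)$ into these two algebras are injective: both $$Q\circ i:C_0(T)\to C_0(T)\rtimes_{\alpha,L}\mathbb N\qquad\text{and}\qquad k_A:C_0(T)\to\mathcal O(M_L)$$ are injective. -/

import Mathlib

open scoped ENNReal ZeroAtInfty

universe u

noncomputable section

namespace ExelCrossedProduct

/-- The algebraic core of the Cauchy-Schwarz inequality for `A`-valued inner products. -/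
theorem norm_sq_le_of_pos {A : Type u} [NonUnitalCStarAlgebra A] {x y z : A} (hx : star x = x)
    (h : ∀ (t : ℝ) (a : A), ∃ b, star a * x * a - (t : ℂ) • (star a * z)
      - (t : ℂ) • (star z * a) + (t ^ 2 : ℂ) • y = star b * b) :
    ‖z‖ ^ 2 ≤ ‖x‖ * ‖y‖ := by
  let _ : PartialOrder A := CStarAlgebra.spectralOrder A
  have _ : StarOrderedRing A := CStarAlgebra.spectralOrderedRing A
  have hN0 : 0 ≤ ‖x‖ := norm_nonneg _
  have main : ∀ t : ℝ, (2 * t - ‖x‖) • (star z * z) ≤ t ^ 2 • y := by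
    intro t
    obtain ⟨b, hb⟩ := h t z
    have h0 : 0 ≤ star z * x * z - (t : ℂ) • (star z * z)
      - (t : ℂ) • (star z * z) + (t ^ 2 : ℂ) • y := hb ▸ star_mul_self_nonneg b
    have h1 : star z * x * z ≤ ‖x‖ • (star z * z) :=
      CStarAlgebra.star_left_conjugate_le_norm_smul (hb := hx)
    have h2 := h0.trans (add_le_add_left (sub_le_sub_right (sub_le_sub_right h1 _) _) _)
    rw [← sub_nonneg]
    refine h2.trans_eq ?_
    simp only [← Complex.coe_smul]
    push_cast
    module
  have main2 : ∀ e : ℝ, 0 < e → ‖z‖ ^ 2 ≤ (‖x‖ + e) * ‖y‖ := by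
    intro e he
    have h := main (‖x‖ + e)
    have hpos : 0 ≤ (2 * (‖x‖ + e) - ‖x‖) • (star z * z) :=
      smul_nonneg (by linarith) (star_mul_self_nonneg z)
    have h3 := CStarAlgebra.norm_le_norm_of_nonneg_of_le hpos h
    rw [norm_smul, norm_smul, CStarRing.norm_star_mul_self, Real.norm_of_nonneg (by linarith),
      Real.norm_of_nonneg (by positivity)] at h3
    have h4 : (‖x‖ + e) * ‖z‖ ^ 2 ≤ (‖x‖ + e) * ((‖x‖ + e) * ‖y‖) := by
      nlinarith [mul_nonneg he.le (sq_nonneg ‖z‖)]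
    exact le_of_mul_le_mul_left h4 (by linarith)
  refine ge_of_tendsto (f := fun e => (‖x‖ + e) * ‖y‖) (x := nhdsWithin 0 (Set.Ioi 0)) ?_ ?_
  · refine Filter.Tendsto.mono_left ?_ nhdsWithin_le_nhds
    have : Continuous fun e => (‖x‖ + e) * ‖y‖ := by fun_prop
    simpa using this.tendsto 0
  · filter_upwards [self_mem_nhdsWithin] with e he using main2 e he

/-- The homomorphism `a ↦ (f i a)` into the `ℓ^∞`-product of a family of C*-algebras. -/
def piHom {A : Type*} [NonUnitalCStarAlgebra A] {I : Type*} {B : I → Type*}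
    [∀ i, NonUnitalCStarAlgebra (B i)] (f : ∀ i, A →⋆ₙₐ[ℂ] B i) : A →⋆ₙₐ[ℂ] lp B ∞ where
  toFun a := ⟨fun i => f i a, memℓp_infty ⟨‖a‖, by
    rintro _ ⟨i, rfl⟩
    exact NonUnitalStarAlgHom.norm_apply_le (f i) a⟩⟩
  map_smul' c a := by ext i; exact map_smul (f i) c a
  map_zero' := by ext i; exact map_zero (f i)
  map_add' a b := by ext i; exact map_add (f i) a b
  map_mul' a b := by ext i; exact map_mul (f i) a b
  map_star' a := by ext i; exact map_star (f i) a

/-- The coordinate homomorphism of the `ℓ^∞`-product of a family of C*-algebras. -/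
def evalHom {I : Type*} {B : I → Type*} [∀ i, NonUnitalCStarAlgebra (B i)] (i : I) :
    lp B ∞ →⋆ₙₐ[ℂ] B i where
  toFun b := b i
  map_smul' _ _ := rfl
  map_zero' := rfl
  map_add' _ _ := rfl
  map_mul' _ _ := rfl
  map_star' _ := rfl

/-- A Hilbert bimodule over the C*-algebra `A`: a right Hilbert `A`-module `M` (`ract x a` is
`x · a`, and `inner x y` is the `A`-valued inner product, conjugate-linear in `x`) with a left
action of `A` by adjointable operators, given by a homomorphism `φ` (`φ a x` is `a · x`). The
inner product is positive, an element of a C*-algebra being positive exactly when it is of the form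
`b* b`, and the norm of the complete space `M` is the one of the inner product. The order of the
factors follows the convention for right modules. -/
structure HilbertBimodule (A M : Type u) [NonUnitalCStarAlgebra A] [NormedAddCommGroup M]
    [NormedSpace ℂ M] [CompleteSpace M] where
  inner : M →L⋆[ℂ] M →L[ℂ] A
  ract : M →L[ℂ] A →L[ℂ] M
  φ : A →L[ℂ] M →L[ℂ] M
  ract_mul : ∀ x a b, ract x (a * b) = ract (ract x a) b
  inner_ract : ∀ x y a, inner x (ract y a) = inner x y * a
  star_inner : ∀ x y, star (inner x y) = inner y x
  inner_self_pos : ∀ x, ∃ b, inner x x = star b * b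
  norm_sq : ∀ x, ‖x‖ ^ 2 = ‖inner x x‖
  φ_mul : ∀ a b x, φ (a * b) x = φ a (φ b x)
  inner_φ : ∀ a x y, inner (φ a x) y = inner x (φ (star a) y)

namespace HilbertBimodule

variable {A M : Type u} [NonUnitalCStarAlgebra A] [NormedAddCommGroup M]
    [NormedSpace ℂ M] [CompleteSpace M] (X : HilbertBimodule A M)

/-- The operator `Θ x y : z ↦ x · ⟨y, z⟩`. -/
def Θ (x y : M) : M →L[ℂ] M := (X.ract x).comp (X.inner y)

/-- The compact operators on the Hilbert module: the closed linear span of the `Θ x y`. -/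
def compacts : Submodule ℂ (M →L[ℂ] M) :=
  (Submodule.span ℂ {F | ∃ x y, F = X.Θ x y}).topologicalClosure

theorem Θ_mem (x y : M) : X.Θ x y ∈ X.compacts :=
  Submodule.le_topologicalClosure _ (Submodule.subset_span ⟨x, y, rfl⟩)

/-- `J(M) = φ⁻¹(K(M))`. -/
def J : Set A := {a | X.φ a ∈ X.compacts}

/-- A Toeplitz representation `(ψ, π)` of the Hilbert bimodule in the C*-algebra `B`. -/
structure ToeplitzRep (B : Type*) [NonUnitalCStarAlgebra B] where
  ψ : M →ₗ[ℂ] B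
  π : A →⋆ₙₐ[ℂ] B
  ψ_ract : ∀ x a, ψ (X.ract x a) = ψ x * π a
  star_ψ_mul : ∀ x y, star (ψ x) * ψ y = π (X.inner x y)
  ψ_φ : ∀ a x, ψ (X.φ a x) = π a * ψ x

theorem norm_inner_le (x y : M) : ‖X.inner x y‖ ≤ ‖x‖ * ‖y‖ := by
  have key : ‖X.inner x y‖ ^ 2 ≤ ‖X.inner x x‖ * ‖X.inner y y‖ := by
    refine norm_sq_le_of_pos (X.star_inner x x) fun t a => ?_
    obtain ⟨b, hb⟩ := X.inner_self_pos (X.ract x a - (t : ℂ) • y)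
    refine ⟨b, hb ▸ ?_⟩
    have e0 : ∀ z, X.inner (X.ract x a) z = star a * X.inner x z := by
      intro z
      rw [← X.star_inner, X.inner_ract, star_mul, X.star_inner]
    simp only [map_sub, map_smulₛₗ, sub_apply, smul_apply,
      e0, X.inner_ract, X.star_inner, Complex.conj_ofReal, RingHom.id_apply, mul_assoc]
    module
  refine le_of_sq_le_sq ?_ (by positivity)
  rwa [mul_pow, X.norm_sq, X.norm_sq]

namespace ToeplitzRep

variable {X} {B : Type*} [NonUnitalCStarAlgebra B] (R : X.ToeplitzRep B)

theorem norm_ψ_le (x : M) : ‖R.ψ x‖ ≤ ‖x‖ := by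
  refine le_of_sq_le_sq ?_ (norm_nonneg _)
  rw [sq, ← CStarRing.norm_star_mul_self, R.star_ψ_mul, X.norm_sq]
  exact NonUnitalStarAlgHom.norm_apply_le R.π _

/-- The span of the pairs `(Θ x y, ψ(x) ψ(y)*)`. -/
def graph : Submodule ℂ ((M →L[ℂ] M) × B) :=
  Submodule.span ℂ {p | ∃ x y, p = (X.Θ x y, R.ψ x * star (R.ψ y))}

theorem graph_mul_ψ {p : (M →L[ℂ] M) × B} (hp : p ∈ R.graph) (z : M) :
    p.2 * R.ψ z = R.ψ (p.1 z) := by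
  induction hp using Submodule.span_induction with
  | mem p hp =>
    obtain ⟨x, y, rfl⟩ := hp
    simp only [Θ, ContinuousLinearMap.comp_apply, mul_assoc, R.star_ψ_mul, R.ψ_ract]
  | zero => simp
  | add p q _ _ hp hq => simp [add_mul, hp, hq]
  | smul c p _ hp => simp [smul_mul_assoc, hp]

theorem graph_star {p : (M →L[ℂ] M) × B} (hp : p ∈ R.graph) :
    ∃ F : M →L[ℂ] M, (F, star p.2) ∈ R.graph ∧ ∀ x y, X.inner (p.1 x) y = X.inner x (F y) := by
  induction hp using Submodule.span_induction with
  | mem p hp =>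
    obtain ⟨x, y, rfl⟩ := hp
    refine ⟨X.Θ y x, Submodule.subset_span ⟨y, x, by simp⟩, fun z w => ?_⟩
    simp only [Θ, ContinuousLinearMap.comp_apply, X.inner_ract]
    rw [← X.star_inner, X.inner_ract, star_mul, X.star_inner, X.star_inner]
  | zero => exact ⟨0, by rw [Prod.snd_zero, star_zero]; exact R.graph.zero_mem, by simp⟩
  | add p q _ _ hp hq =>
    obtain ⟨F, h1, h2⟩ := hp
    obtain ⟨G, h3, h4⟩ := hq
    exact ⟨F + G, by simpa using Submodule.add_mem _ h1 h3, fun x y => by simp [h2, h4]⟩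
  | smul c p _ hp =>
    obtain ⟨F, h1, h2⟩ := hp
    exact ⟨star c • F, by simpa using Submodule.smul_mem _ (star c) h1, fun x y => by simp [h2]⟩

theorem graph_mul_bound {p : (M →L[ℂ] M) × B} (hp : p ∈ R.graph) :
    ∃ C : ℝ, ∀ (T : M →L[ℂ] M) (d : B), (∀ z, d * R.ψ z = R.ψ (T z)) →
      ‖d * p.2‖ ≤ C * ‖T‖ := by
  induction hp using Submodule.span_induction with
  | mem p hp =>
    obtain ⟨x, y, rfl⟩ := hp
    refine ⟨‖x‖ * ‖y‖, fun T d h => ?_⟩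
    simp only [← mul_assoc, h]
    refine (norm_mul_le _ _).trans ?_
    rw [norm_star]
    have h1 := (R.norm_ψ_le (T x)).trans (T.le_opNorm x)
    have h2 := R.norm_ψ_le y
    calc _ ≤ (‖T‖ * ‖x‖) * ‖y‖ := by gcongr
      _ = _ := by ring
  | zero => exact ⟨0, by simp⟩
  | add p q _ _ hp hq =>
    obtain ⟨C, h1⟩ := hp
    obtain ⟨D, h2⟩ := hq
    refine ⟨C + D, fun T d h => ?_⟩
    rw [Prod.snd_add, mul_add, add_mul]
    exact (norm_add_le _ _).trans (add_le_add (h1 T d h) (h2 T d h))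
  | smul c p _ hp =>
    obtain ⟨C, h1⟩ := hp
    refine ⟨‖c‖ * C, fun T d h => ?_⟩
    rw [Prod.smul_snd, mul_smul_comm, norm_smul, mul_assoc]
    gcongr
    exact h1 T d h

theorem norm_le_of_mem_graph {p : (M →L[ℂ] M) × B} (hp : p ∈ R.graph) : ‖p.2‖ ≤ ‖p.1‖ := by
  obtain ⟨F, hF, hadj⟩ := R.graph_star hp
  have hFn : ‖F‖ ≤ ‖p.1‖ := by
    refine F.opNorm_le_bound (norm_nonneg _) fun y => ?_
    have h1 : ‖F y‖ ^ 2 ≤ ‖p.1‖ * ‖F y‖ * ‖y‖ := by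
      rw [X.norm_sq, ← hadj]
      exact (X.norm_inner_le _ _).trans (by gcongr; exact p.1.le_opNorm _)
    rcases (norm_nonneg (F y)).eq_or_lt with h0 | h0
    · rw [← h0]; positivity
    · nlinarith
  set c : B := star p.2 * p.2 with hc
  set S : M →L[ℂ] M := F.comp p.1 with hS
  have hcS : ∀ z, c * R.ψ z = R.ψ (S z) := fun z => by
    rw [hc, mul_assoc, R.graph_mul_ψ hp, R.graph_mul_ψ hF]; rfl
  obtain ⟨C, hC⟩ : ∃ C : ℝ, ∀ (T : M →L[ℂ] M) (d : B), (∀ z, d * R.ψ z = R.ψ (T z)) →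
      ‖d * c‖ ≤ C * ‖T‖ := by
    obtain ⟨C, hC⟩ := R.graph_mul_bound hp
    refine ⟨|C| * ‖F‖, fun T d h => ?_⟩
    have h1 := hC (T.comp F) (d * star p.2) fun z => by
      rw [mul_assoc, R.graph_mul_ψ hF, h]; rfl
    rw [hc, ← mul_assoc]
    refine h1.trans ?_
    calc C * ‖T.comp F‖ ≤ |C| * (‖T‖ * ‖F‖) := by
          gcongr
          · exact le_abs_self C
          · exact T.opNorm_comp_le F
      _ = _ := by ring
  have hpow : ∀ m : ℕ, ∃ d : B, (d : Unitization ℂ B) = (c : Unitization ℂ B) ^ (m + 1) ∧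
      ∀ z, d * R.ψ z = R.ψ ((S ^ (m + 1)) z) := by
    intro m
    induction m with
    | zero => exact ⟨c, by simp, by simpa using hcS⟩
    | succ m ih =>
      obtain ⟨d, h1, h2⟩ := ih
      refine ⟨d * c, by rw [Unitization.inr_mul, h1, pow_succ _ (m + 1)], fun z => ?_⟩
      rw [mul_assoc, hcS, h2, pow_succ S (m + 1)]
      rfl
  have hsa : IsSelfAdjoint (c : Unitization ℂ B) := by
    rw [IsSelfAdjoint, ← Unitization.inr_star, hc]; simp
  have hbound : ∀ n : ℕ, ‖c‖ ^ 2 ^ (n + 1) * ‖S‖ ≤ |C| * ‖S‖ ^ 2 ^ (n + 1) := by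
    intro n
    obtain ⟨m, hm⟩ : ∃ m, 2 ^ (n + 1) = m + 2 :=
      ⟨2 ^ (n + 1) - 2, by have := Nat.pow_le_pow_right two_pos (Nat.le_add_left 1 n); omega⟩
    obtain ⟨d, h1, h2⟩ := hpow m
    have h3 : ‖d * c‖ = ‖c‖ ^ 2 ^ (n + 1) := by
      rw [← Unitization.norm_inr (𝕜 := ℂ) (d * c), Unitization.inr_mul, h1, ← pow_succ,
        show m + 1 + 1 = 2 ^ (n + 1) from hm.symm, hsa.norm_pow_two_pow, Unitization.norm_inr]
    have hCd := hC _ d h2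
    rw [h3] at hCd
    have hC0 : 0 ≤ |C| := abs_nonneg C
    calc ‖c‖ ^ 2 ^ (n + 1) * ‖S‖ ≤ (|C| * ‖S ^ (m + 1)‖) * ‖S‖ := by
          gcongr
          exact hCd.trans (by gcongr; exact le_abs_self C)
      _ ≤ (|C| * ‖S‖ ^ (m + 1)) * ‖S‖ := by
          gcongr
          exact norm_pow_le' S (Nat.succ_pos m)
      _ = |C| * ‖S‖ ^ 2 ^ (n + 1) := by rw [hm]; ring
  have hcle : ‖c‖ ≤ ‖S‖ := by
    by_contra! hlt
    rcases (norm_nonneg S).eq_or_lt with h0 | h0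
    · have h1 := hC S c hcS
      rw [← h0, mul_zero] at h1
      have h2 := CStarRing.norm_star_mul_self (x := c)
      rw [show star c = c by rw [hc]; simp] at h2
      rw [h2] at h1
      nlinarith
    · have h1 : 1 < ‖c‖ / ‖S‖ := (one_lt_div h0).mpr hlt
      obtain ⟨k, hk⟩ := pow_unbounded_of_one_lt (|C| / ‖S‖) h1
      have h2 : (‖c‖ / ‖S‖) ^ k ≤ (‖c‖ / ‖S‖) ^ 2 ^ (k + 1) :=
        pow_le_pow_right₀ h1.le ((Nat.lt_two_pow_self (n := k)).le.trans
          (Nat.pow_le_pow_right two_pos (Nat.le_succ k)))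
      have h3 := hk.trans_le h2
      rw [div_pow, div_lt_div_iff₀ h0 (by positivity)] at h3
      exact absurd (hbound k) (not_le.mpr h3)
  have h4 : ‖p.2‖ * ‖p.2‖ ≤ ‖p.1‖ * ‖p.1‖ := by
    rw [← CStarRing.norm_star_mul_self]
    refine hcle.trans ((F.opNorm_comp_le p.1).trans ?_)
    gcongr
  exact abs_le_of_sq_le_sq' (by nlinarith) (norm_nonneg _) |>.2

/-- For every Toeplitz representation there is a bounded linear map `(ψ, π)⁽¹⁾` of the compact
operators into `B` that sends `Θ x y` to `ψ(x) ψ(y)*`. By density there is only one. -/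
theorem exists_one : ∃ ρ : X.compacts →L[ℂ] B,
    ∀ x y, ρ ⟨X.Θ x y, X.Θ_mem x y⟩ = R.ψ x * star (R.ψ y) := by
  set G := R.graph.topologicalClosure with hG
  have hle : ∀ p ∈ G, ‖p.2‖ ≤ ‖p.1‖ := by
    intro p hp
    refine closure_minimal (t := {p : (M →L[ℂ] M) × B | ‖p.2‖ ≤ ‖p.1‖})
      (fun p hp => R.norm_le_of_mem_graph hp)
      (isClosed_le (by fun_prop) (by fun_prop)) hp
  have huniq : ∀ F b b', (F, b) ∈ G → (F, b') ∈ G → b = b' := by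
    intro F b b' h h'
    have := hle _ (G.sub_mem h h')
    simpa [sub_eq_zero] using this
  have hclosed : IsClosed (Set.range fun p : G => p.1.1) := by
    have : CompleteSpace G := R.graph.isClosed_topologicalClosure.completeSpace_coe
    refine AntilipschitzWith.isClosed_range (K := 1) ?_
      (uniformContinuous_fst.comp uniformContinuous_subtype_val)
    refine AntilipschitzWith.of_le_mul_dist fun p q => ?_
    have h := hle _ (G.sub_mem p.2 q.2)
    rw [NNReal.coe_one, one_mul, Subtype.dist_eq, dist_eq_norm, dist_eq_norm, Prod.norm_def]
    exact max_le le_rfl h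
  have hex : ∀ F : X.compacts, ∃ b, ((F : M →L[ℂ] M), b) ∈ G := by
    intro F
    have hsub : (Submodule.span ℂ {F | ∃ x y, F = X.Θ x y} : Set (M →L[ℂ] M)) ⊆
        Set.range fun p : G => p.1.1 := by
      have h1 : Submodule.span ℂ {F | ∃ x y, F = X.Θ x y} ≤
          G.map (LinearMap.fst ℂ (M →L[ℂ] M) B) := by
        rw [Submodule.span_le]
        rintro _ ⟨x, y, rfl⟩
        exact ⟨_, Submodule.le_topologicalClosure _ (Submodule.subset_span ⟨x, y, rfl⟩), rfl⟩
      intro F hF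
      obtain ⟨p, hp, rfl⟩ := h1 hF
      exact ⟨⟨p, hp⟩, rfl⟩
    obtain ⟨p, hp⟩ := closure_minimal hsub hclosed F.2
    exact ⟨p.1.2, by rw [← hp]; exact p.2⟩
  choose ρ hρ using hex
  refine ⟨LinearMap.mkContinuous
    { toFun := ρ
      map_add' := fun F F' => huniq _ _ _ (hρ _) (G.add_mem (hρ F) (hρ F'))
      map_smul' := fun c F => huniq _ _ _ (hρ _) (G.smul_mem c (hρ F)) } 1
    fun F => by rw [one_mul]; exact hle _ (hρ F), fun x y => ?_⟩
  exact huniq _ _ _ (hρ _)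
    (Submodule.le_topologicalClosure _ (Submodule.subset_span ⟨x, y, rfl⟩))

/-- The map `(ψ, π)⁽¹⁾` of the compact operators into `B`, determined by `one_Θ`. -/
def one : X.compacts →L[ℂ] B := R.exists_one.choose

theorem one_Θ (x y : M) : R.one ⟨X.Θ x y, X.Θ_mem x y⟩ = R.ψ x * star (R.ψ y) :=
  R.exists_one.choose_spec x y

/-- `(ψ, π)` is coisometric on `K`: `(ψ, π)⁽¹⁾(φ(a)) = π(a)` for all `a ∈ K`. -/
def IsCoisometricOn (K : Set A) : Prop :=
  ∀ a ∈ K, ∃ h : X.φ a ∈ X.compacts, R.one ⟨X.φ a, h⟩ = R.π a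

end ToeplitzRep
end HilbertBimodule

namespace HilbertBimodule

variable {A M : Type u} [NonUnitalCStarAlgebra A] [NormedAddCommGroup M]
    [NormedSpace ℂ M] [CompleteSpace M] (X : HilbertBimodule A M) (K : Set A)

/-- The Toeplitz representations that are coisometric on `K`, in C*-algebras of the universe of
`A` and `M`. This universe is large enough: the C*-algebra generated by the images of `A` and `M`
always has a copy in it. -/
structure CoisometricRep : Type (u + 1) where
  B : Type u
  [instB : NonUnitalCStarAlgebra B]
  rep : X.ToeplitzRep B
  coisometric : rep.IsCoisometricOn K

attribute [instance] CoisometricRep.instB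

/-- The `ℓ^∞`-product of the target algebras of all representations coisometric on `K`. -/
abbrev RepProduct : Type (u + 1) := lp (fun R : X.CoisometricRep K => R.B) ∞

/-- The product of the maps `ψ` over all representations. -/
def piM (x : M) : X.RepProduct K :=
  ⟨fun R => R.rep.ψ x, memℓp_infty ⟨‖x‖, by rintro _ ⟨R, rfl⟩; exact R.rep.norm_ψ_le x⟩⟩

/-- The product of the maps `π` over all representations. -/
def piA : A →⋆ₙₐ[ℂ] X.RepProduct K := piHom fun R => R.rep.π

/-- The C*-subalgebra generated by the product of all representations coisometric on `K`. -/
def relCuntzPimsner : NonUnitalStarSubalgebra ℂ (X.RepProduct K) :=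
  (NonUnitalStarAlgebra.adjoin ℂ (Set.range (X.piM K) ∪ Set.range (X.piA K))).topologicalClosure

instance : IsClosed (X.relCuntzPimsner K : Set (X.RepProduct K)) :=
  NonUnitalStarSubalgebra.isClosed_topologicalClosure _

/-- The relative Cuntz-Pimsner algebra `O(K, M)`: the C*-algebra generated by a universal Toeplitz
representation `(kM, kA)` that is coisometric on `K`. -/
abbrev RelCuntzPimsner : Type (u + 1) := X.relCuntzPimsner K

/-- The linear half `k_M : M → O(K, M)` of the universal representation. -/
def kM : M →ₗ[ℂ] X.RelCuntzPimsner K where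
  toFun x := ⟨X.piM K x, NonUnitalStarSubalgebra.le_topologicalClosure _
    (NonUnitalStarAlgebra.subset_adjoin ℂ _ (Or.inl ⟨x, rfl⟩))⟩
  map_add' x y := by ext R; exact map_add R.rep.ψ x y
  map_smul' c x := by ext R; exact map_smul R.rep.ψ c x

/-- The homomorphism `k_A : A → O(K, M)` of the universal representation. -/
def kA : A →⋆ₙₐ[ℂ] X.RelCuntzPimsner K :=
  NonUnitalStarAlgHom.codRestrict (X.piA K) (X.relCuntzPimsner K) fun a =>
    NonUnitalStarSubalgebra.le_topologicalClosure _
      (NonUnitalStarAlgebra.subset_adjoin ℂ _ (Or.inr ⟨a, rfl⟩))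

/-- Every Toeplitz representation coisometric on `K` factors through the universal one. -/
theorem exists_lift {B : Type u} [NonUnitalCStarAlgebra B] (R : X.ToeplitzRep B)
    (hR : R.IsCoisometricOn K) : ∃ ρ : X.RelCuntzPimsner K →⋆ₙₐ[ℂ] B,
      (∀ x, ρ (X.kM K x) = R.ψ x) ∧ ∀ a, ρ (X.kA K a) = R.π a :=
  ⟨(evalHom (⟨B, R, hR⟩ : X.CoisometricRep K)).comp
    (NonUnitalStarSubalgebraClass.subtype (X.relCuntzPimsner K)), fun _ => rfl, fun _ => rfl⟩

/-- The Cuntz-Pimsner algebra `O(M) = O(J(M), M)`. -/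
abbrev CuntzPimsner : Type (u + 1) := X.RelCuntzPimsner X.J

/-- The canonical homomorphism `k_A : A → O(M)`. -/
def cuntzPimsnerHom : A →⋆ₙₐ[ℂ] X.CuntzPimsner := X.kA X.J

end HilbertBimodule

/-- An endomorphism `α` of the C*-algebra `A` with a bounded positive linear map `L` such that
`L (α(a) m) = a L(m)`. The bimodule, the Toeplitz crossed product and the crossed product below use
only these data. An Exel system has moreover extensions of `α` and `L` to the multiplier algebra;
in the case of classical systems these exist automatically. -/
structure TransferSystem (A : Type u) [NonUnitalCStarAlgebra A] where
  α : A →⋆ₙₐ[ℂ] A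
  L : A →L[ℂ] A
  L_pos : ∀ a, ∃ b, L (star a * a) = star b * b
  L_mul : ∀ a m, L (α a * m) = a * L m

/-- A closed two-sided ideal of a C*-algebra. -/
structure ClosedIdeal (B : Type*) [NonUnitalCStarAlgebra B] extends Submodule ℂ B where
  isClosed : IsClosed carrier
  mul_left_mem : ∀ b x, x ∈ carrier → b * x ∈ carrier
  mul_right_mem : ∀ b x, x ∈ carrier → x * b ∈ carrier

namespace ClosedIdeal

variable {B : Type*} [NonUnitalCStarAlgebra B]

/-- The closed two-sided ideal generated by a set. -/
def generate (s : Set B) : ClosedIdeal B where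
  toSubmodule := sInf {J | IsClosed (J : Set B) ∧ (∀ b, ∀ x ∈ J, b * x ∈ J ∧ x * b ∈ J) ∧
    s ⊆ (J : Set B)}
  isClosed := by
    change IsClosed ((sInf {J : Submodule ℂ B | IsClosed (J : Set B) ∧
      (∀ b, ∀ x ∈ J, b * x ∈ J ∧ x * b ∈ J) ∧ s ⊆ (J : Set B)} : Submodule ℂ B) : Set B)
    rw [Submodule.coe_sInf]
    exact isClosed_biInter fun J hJ => hJ.1
  mul_left_mem b x hx := by
    refine (Submodule.mem_sInf).mpr fun J hJ => (hJ.2.1 b x ?_).1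
    exact (Submodule.mem_sInf).mp hx J hJ
  mul_right_mem b x hx := by
    refine (Submodule.mem_sInf).mpr fun J hJ => (hJ.2.1 b x ?_).2
    exact (Submodule.mem_sInf).mp hx J hJ

variable (I : ClosedIdeal B)

/-- The self-adjoint part `I ∩ I*`. -/
def starPart : NonUnitalStarSubalgebra ℂ B where
  carrier := {x | x ∈ I.toSubmodule ∧ star x ∈ I.toSubmodule}
  zero_mem' := ⟨zero_mem _, by rw [star_zero]; exact zero_mem _⟩
  add_mem' h k := ⟨add_mem h.1 k.1, by rw [star_add]; exact add_mem h.2 k.2⟩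
  mul_mem' {a b} h k := ⟨I.mul_left_mem a b k.1, by
    rw [star_mul]; exact I.mul_left_mem _ _ h.2⟩
  smul_mem' c x h := ⟨Submodule.smul_mem _ c h.1, by
    rw [star_smul]; exact Submodule.smul_mem _ _ h.2⟩
  star_mem' h := ⟨h.2, by rw [star_star]; exact h.1⟩

instance : IsClosed (I.starPart : Set B) :=
  I.isClosed.inter (I.isClosed.preimage continuous_star)

/-- Approximate units: elements `e` of the ideal that almost fix a given `j`. -/
theorem exists_approx {j : B} (hj : j ∈ I.starPart) {ε : ℝ} (hε : 0 < ε) :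
    ∃ e ∈ I.toSubmodule, star e = e ∧
      (∀ z, ‖z - z * e - e * z + e * z * e‖ ≤ ‖z‖) ∧
      ‖j - j * e - e * j + e * j * e‖ ≤ ε := by
  let _ : PartialOrder B := CStarAlgebra.spectralOrder B
  have _ : StarOrderedRing B := CStarAlgebra.spectralOrderedRing B
  let _ : PartialOrder I.starPart := CStarAlgebra.spectralOrder I.starPart
  have _ : StarOrderedRing I.starPart := CStarAlgebra.spectralOrderedRing I.starPart
  have hl := CStarAlgebra.increasingApproximateUnit (A := I.starPart)
  have h1 := hl.tendsto_mul_left ⟨j, hj⟩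
  have h2 := (Metric.tendsto_nhds.mp h1 ε hε).and (hl.eventually_nonneg.and hl.eventually_norm)
  obtain ⟨e, he1, he2, he3⟩ := h2.exists
  have he0 : (0 : B) ≤ e := by
    obtain ⟨d, hd⟩ := CStarAlgebra.nonneg_iff_eq_star_mul_self.mp he2
    rw [hd]
    exact star_mul_self_nonneg (d : B)
  have hesa : star (e : B) = e := (IsSelfAdjoint.of_nonneg he0)
  set u : Unitization ℂ B := 1 - (e : B) with hu
  have hu0 : (0 : Unitization ℂ B) ≤ ((e : B) : Unitization ℂ B) := by
    rwa [Unitization.inr_nonneg_iff]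
  have hu1 : ((e : B) : Unitization ℂ B) ≤ 1 := by
    rw [← CStarAlgebra.norm_le_one_iff_of_nonneg _ hu0, Unitization.norm_inr]
    exact he3
  have hun : ‖u‖ ≤ 1 := by
    rw [CStarAlgebra.norm_le_one_iff_of_nonneg _ (sub_nonneg.mpr hu1)]
    exact sub_le_self _ hu0
  refine ⟨e, e.2.1, hesa, fun z => ?_, ?_⟩
  · have : ((z - z * e - e * z + e * z * e : B) : Unitization ℂ B) = u * z * u := by
      rw [hu]
      simp only [Unitization.inr_add, Unitization.inr_sub, Unitization.inr_mul]
      noncomm_ring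
    rw [← Unitization.norm_inr (𝕜 := ℂ), this]
    calc ‖u * (z : Unitization ℂ B) * u‖ ≤ ‖u‖ * ‖(z : Unitization ℂ B)‖ * ‖u‖ :=
          norm_mul₃_le
      _ ≤ 1 * ‖z‖ * 1 := by
          rw [Unitization.norm_inr]; gcongr
      _ = ‖z‖ := by ring
  · have h3 : ‖j - j * e‖ ≤ ε := by
      have := he1.le
      rw [dist_comm, Subtype.dist_eq, dist_eq_norm] at this
      exact this
    have : ((j - j * e - e * j + e * j * e : B) : Unitization ℂ B) = u * (j - j * e : B) := by
      rw [hu]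
      simp only [Unitization.inr_add, Unitization.inr_sub, Unitization.inr_mul]
      noncomm_ring
    rw [← Unitization.norm_inr (𝕜 := ℂ), this]
    calc ‖u * ((j - j * e : B) : Unitization ℂ B)‖
        ≤ ‖u‖ * ‖((j - j * e : B) : Unitization ℂ B)‖ := norm_mul_le _ _
      _ ≤ 1 * ε := by
          rw [Unitization.norm_inr]; gcongr
      _ = ε := one_mul ε

theorem norm_sub_mul_sq {e : B} (he : star e = e) (b : B) :
    ‖b - b * e‖ ^ 2 = ‖star b * b - star b * b * e - e * (star b * b) + e * (star b * b) * e‖ := by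
  rw [sq, ← CStarRing.norm_star_mul_self]
  congr 1
  simp only [star_sub, star_mul, he]
  noncomm_ring

/-- Closed ideals of a C*-algebra are self-adjoint. -/
theorem star_mem {x : B} (hx : x ∈ I.toSubmodule) : star x ∈ I.toSubmodule := by
  have hj : x * star x ∈ I.starPart := by
    refine ⟨I.mul_right_mem _ _ hx, ?_⟩
    rw [star_mul, star_star]; exact I.mul_right_mem _ _ hx
  refine I.isClosed.closure_subset (Metric.mem_closure_iff.mpr fun ε hε => ?_)
  obtain ⟨e, he, hes, -, h3⟩ := I.exists_approx hj (ε := ε ^ 2 / 4) (by positivity)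
  refine ⟨star x * e, I.mul_left_mem _ _ he, ?_⟩
  have h4 := norm_sub_mul_sq hes (star x)
  rw [star_star] at h4
  rw [dist_eq_norm]
  refine lt_of_pow_lt_pow_left₀ 2 hε.le ?_
  rw [h4]
  refine h3.trans_lt ?_
  linarith [pow_pos hε 2]

/-- The quotient of a C*-algebra by a closed two-sided ideal, with the quotient norm. -/
abbrev Quotient : Type _ := B ⧸ I.toSubmodule

instance : IsClosed (I.toSubmodule : Set B) := I.isClosed

instance : Mul I.Quotient where
  mul := Quotient.map₂ (· * ·) fun a a' h b b' k => by
    replace h := (Submodule.quotientRel_def _).mp h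
    replace k := (Submodule.quotientRel_def _).mp k
    refine (Submodule.quotientRel_def _).mpr ?_
    have : a * b - a' * b' = (a - a') * b + a' * (b - b') := by noncomm_ring
    rw [this]
    exact add_mem (I.mul_right_mem _ _ h) (I.mul_left_mem _ _ k)

instance : Star I.Quotient where
  star := Quotient.map star fun a a' h => by
    replace h := (Submodule.quotientRel_def _).mp h
    refine (Submodule.quotientRel_def _).mpr ?_
    rw [← star_sub]
    exact I.star_mem h

theorem mk_mul (a b : B) : (Submodule.Quotient.mk (a * b) : I.Quotient)
    = Submodule.Quotient.mk a * Submodule.Quotient.mk b := rfl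

theorem mk_star (a : B) : (Submodule.Quotient.mk (star a) : I.Quotient)
    = star (Submodule.Quotient.mk a) := rfl

theorem exists_rep (x : I.Quotient) {ε : ℝ} (hε : 0 < ε) :
    ∃ a : B, Submodule.Quotient.mk a = x ∧ ‖a‖ < ‖x‖ + ε :=
  Submodule.Quotient.norm_mk_lt x hε

instance : NonUnitalRing I.Quotient where
  left_distrib x y z := by
    induction x using Submodule.Quotient.induction_on
    induction y using Submodule.Quotient.induction_on
    induction z using Submodule.Quotient.induction_on
    simp only [← mk_mul, ← Submodule.Quotient.mk_add, mul_add]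
  right_distrib x y z := by
    induction x using Submodule.Quotient.induction_on
    induction y using Submodule.Quotient.induction_on
    induction z using Submodule.Quotient.induction_on
    simp only [← mk_mul, ← Submodule.Quotient.mk_add, add_mul]
  zero_mul x := by
    induction x using Submodule.Quotient.induction_on
    rw [← Submodule.Quotient.mk_zero, ← mk_mul, zero_mul]
  mul_zero x := by
    induction x using Submodule.Quotient.induction_on
    rw [← Submodule.Quotient.mk_zero, ← mk_mul, mul_zero]
  mul_assoc x y z := by
    induction x using Submodule.Quotient.induction_on
    induction y using Submodule.Quotient.induction_on
    induction z using Submodule.Quotient.induction_on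
    simp only [← mk_mul, mul_assoc]

instance : NonUnitalNormedRing I.Quotient where
  dist_eq x y := dist_eq_norm_neg_add x y
  norm_mul_le x y := by
    have h : ∀ ε : ℝ, 0 < ε → ‖x * y‖ ≤ (‖x‖ + ε) * (‖y‖ + ε) := by
      intro ε hε
      obtain ⟨a, rfl, ha⟩ := I.exists_rep x hε
      obtain ⟨b, rfl, hb⟩ := I.exists_rep y hε
      rw [← mk_mul]
      refine (Submodule.Quotient.norm_mk_le _ _).trans ((norm_mul_le a b).trans ?_)
      gcongr
    refine ge_of_tendsto (f := fun e => (‖x‖ + e) * (‖y‖ + e)) (x := nhdsWithin 0 (Set.Ioi 0))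
      ?_ ?_
    · refine Filter.Tendsto.mono_left ?_ nhdsWithin_le_nhds
      have : Continuous fun e => (‖x‖ + e) * (‖y‖ + e) := by fun_prop
      simpa using this.tendsto 0
    · filter_upwards [self_mem_nhdsWithin] with e he using h e he

instance : StarRing I.Quotient where
  star_involutive x := by
    induction x using Submodule.Quotient.induction_on
    simp only [← mk_star, star_star]
  star_mul x y := by
    induction x using Submodule.Quotient.induction_on
    induction y using Submodule.Quotient.induction_on
    simp only [← mk_star, ← mk_mul, star_mul]
  star_add x y := by
    induction x using Submodule.Quotient.induction_on
    induction y using Submodule.Quotient.induction_on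
    simp only [← mk_star, ← Submodule.Quotient.mk_add, star_add]

instance : CStarRing I.Quotient where
  norm_mul_self_le x := by
    refine le_of_forall_pos_le_add fun ε hε => ?_
    obtain ⟨b, rfl⟩ := Submodule.Quotient.mk_surjective _ x
    obtain ⟨c, hc, hcn⟩ := I.exists_rep
      (star (Submodule.Quotient.mk b : I.Quotient) * Submodule.Quotient.mk b) (half_pos hε)
    rw [← mk_star, ← mk_mul, Submodule.Quotient.eq] at hc
    have hj : c - star b * b ∈ I.starPart := ⟨hc, I.star_mem hc⟩
    obtain ⟨e, he, hes, h1, h2⟩ := I.exists_approx hj (half_pos hε)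
    have h3 : ‖(Submodule.Quotient.mk b : I.Quotient)‖ ≤ ‖b - b * e‖ := by
      have : (Submodule.Quotient.mk b : I.Quotient) = Submodule.Quotient.mk (b - b * e) := by
        rw [Submodule.Quotient.eq, sub_sub_cancel]
        exact I.mul_left_mem _ _ he
      rw [this]
      exact Submodule.Quotient.norm_mk_le _ _
    have h4 := norm_sub_mul_sq hes b
    have h5 : star b * b - star b * b * e - e * (star b * b) + e * (star b * b) * e
        = (c - c * e - e * c + e * c * e) - ((c - star b * b) - (c - star b * b) * e
          - e * (c - star b * b) + e * (c - star b * b) * e) := by noncomm_ring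
    rw [h5] at h4
    have h6 := norm_sub_le (c - c * e - e * c + e * c * e) ((c - star b * b)
      - (c - star b * b) * e - e * (c - star b * b) + e * (c - star b * b) * e)
    have h7 := h1 c
    have h8 := norm_nonneg (Submodule.Quotient.mk b : I.Quotient)
    nlinarith

instance : NonUnitalCStarAlgebra I.Quotient where
  smul_assoc c x y := by
    induction x using Submodule.Quotient.induction_on
    induction y using Submodule.Quotient.induction_on
    simp only [smul_eq_mul, ← Submodule.Quotient.mk_smul, ← mk_mul, smul_mul_assoc]
  smul_comm c x y := by
    induction x using Submodule.Quotient.induction_on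
    induction y using Submodule.Quotient.induction_on
    simp only [smul_eq_mul, ← Submodule.Quotient.mk_smul, ← mk_mul, mul_smul_comm]
  star_smul c x := by
    induction x using Submodule.Quotient.induction_on
    simp only [← Submodule.Quotient.mk_smul, ← mk_star, star_smul]

/-- The quotient homomorphism. -/
def mkHom : B →⋆ₙₐ[ℂ] I.Quotient where
  toFun := Submodule.Quotient.mk
  map_smul' _ _ := rfl
  map_zero' := rfl
  map_add' _ _ := rfl
  map_mul' _ _ := rfl
  map_star' _ := rfl

end ClosedIdeal

namespace TransferSystem

variable {A : Type u} [NonUnitalCStarAlgebra A] (S : TransferSystem A)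

/-- The polarisation identity gives `L (m* n)* = L (n* m)`. -/
theorem star_L_star_mul (m n : A) : star (S.L (star m * n)) = S.L (star n * m) := by
  have key : ∀ x : A, star (S.L (star x * x)) = S.L (star x * x) := by
    intro x
    obtain ⟨b, hb⟩ := S.L_pos x
    rw [hb]; simp
  have h1 := key (m + n)
  have h2 := key (m + Complex.I • n)
  have hm := key m
  have hn := key n
  simp only [star_add, star_smul, add_mul, mul_add, smul_mul_assoc, mul_smul_comm, map_add,
    map_smul, hm, hn] at h1 h2
  simp only [Complex.star_def, Complex.conj_I, map_neg] at h2
  have e3 : (2 : ℂ) • star (S.L (star m * n)) = (2 : ℂ) • S.L (star n * m) := by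
    linear_combination (norm := skip) h1 + Complex.I • h2
    match_scalars <;> ring_nf <;> simp
  exact smul_right_injective A (two_ne_zero (α := ℂ)) e3

theorem norm_L_mul_le (a m : A) :
    ‖S.L (star (a * m) * (a * m))‖ ≤ ‖a‖ ^ 2 * ‖S.L (star m * m)‖ := by
  let _ : PartialOrder A := CStarAlgebra.spectralOrder A
  have _ : StarOrderedRing A := CStarAlgebra.spectralOrderedRing A
  have mono : ∀ x : A, 0 ≤ x → 0 ≤ S.L x := by
    intro x hx
    obtain ⟨y, rfl⟩ := CStarAlgebra.nonneg_iff_eq_star_mul_self.mp hx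
    obtain ⟨b, hb⟩ := S.L_pos y
    rw [hb]; exact star_mul_self_nonneg b
  have h : star (a * m) * (a * m) ≤ ‖star a * a‖ • (star m * m) := by
    have := CStarAlgebra.star_left_conjugate_le_norm_smul (a := m) (b := star a * a)
    simpa [star_mul, mul_assoc] using this
  have h2 : S.L (star (a * m) * (a * m)) ≤ ‖star a * a‖ • S.L (star m * m) := by
    have := mono _ (sub_nonneg.mpr h)
    rw [map_sub, sub_nonneg] at this
    refine this.trans_eq ?_
    exact (S.L.restrictScalars ℝ).map_smul _ _
  have h3 := CStarAlgebra.norm_le_norm_of_nonneg_of_le (mono _ (star_mul_self_nonneg _)) h2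
  rwa [norm_smul, norm_norm, CStarRing.norm_star_mul_self, ← sq] at h3


theorem L_star_mul_mul_α (m n a : A) : S.L (star m * (n * S.α a)) = S.L (star m * n) * a := by
  have h := S.star_L_star_mul (n * S.α a) m
  rw [star_mul, ← map_star S.α, mul_assoc, S.L_mul, star_mul, star_star, S.star_L_star_mul] at h
  exact h.symm

theorem norm_L_star_mul_sq_le (m n : A) :
    ‖S.L (star m * n)‖ ^ 2 ≤ ‖S.L (star m * m)‖ * ‖S.L (star n * n)‖ := by
  refine norm_sq_le_of_pos (S.star_L_star_mul m m) fun t a => ?_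
  obtain ⟨b, hb⟩ := S.L_pos (m * S.α a - (t : ℂ) • n)
  refine ⟨b, hb ▸ ?_⟩
  have e1 : S.L (star (m * S.α a) * (m * S.α a)) = star a * S.L (star m * m) * a := by
    rw [S.L_star_mul_mul_α, star_mul, ← map_star S.α, mul_assoc, S.L_mul]
  have e2 : S.L (star (m * S.α a) * n) = star a * S.L (star m * n) := by
    rw [star_mul, ← map_star S.α, mul_assoc, S.L_mul]
  have e3 : S.L (star n * (m * S.α a)) = star (S.L (star m * n)) * a := by
    rw [S.L_star_mul_mul_α, S.star_L_star_mul]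
  simp only [star_sub, star_smul, sub_mul, mul_sub, map_sub, smul_mul_assoc, mul_smul_comm,
    map_smul, e1, e2, e3, Complex.star_def, Complex.conj_ofReal]
  module

/-- The vector space `A_L`: a copy of `A`, with the pairing `⟨m, n⟩ = L (m* n)`, the right action
`m · a = m α(a)`, the left action `a · m = a m` and the seminorm `‖⟨m, m⟩‖^(1/2)`. -/
def PreModule (_ : TransferSystem A) : Type u := A

namespace PreModule

instance : AddCommGroup S.PreModule := inferInstanceAs (AddCommGroup A)
instance : Module ℂ S.PreModule := inferInstanceAs (Module ℂ A)

/-- The identity map `A → A_L`. -/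
def of : A ≃ₗ[ℂ] S.PreModule := LinearEquiv.refl ℂ A

/-- The pairing `⟨m, n⟩ = L (m* n)`. -/
def pairing (m n : S.PreModule) : A :=
  S.L (star ((of S).symm m) * (of S).symm n)

instance : Norm S.PreModule where
  norm m := √‖pairing S m m‖

theorem norm_sq (m : S.PreModule) : ‖m‖ ^ 2 = ‖pairing S m m‖ :=
  Real.sq_sqrt (norm_nonneg _)

theorem norm_pairing_le (m n : S.PreModule) : ‖pairing S m n‖ ≤ ‖m‖ * ‖n‖ := by
  have h := S.norm_L_star_mul_sq_le ((of S).symm m) ((of S).symm n)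
  refine le_of_sq_le_sq ?_ (mul_nonneg (Real.sqrt_nonneg _) (Real.sqrt_nonneg _))
  rw [mul_pow, norm_sq, norm_sq]
  exact h

theorem core : SeminormedSpace.Core ℂ S.PreModule where
  norm_nonneg _ := Real.sqrt_nonneg _
  norm_smul c m := by
    refine (sq_eq_sq₀ (Real.sqrt_nonneg _) (mul_nonneg (norm_nonneg _) (Real.sqrt_nonneg _))).mp ?_
    change ‖c • m‖ ^ 2 = (‖c‖ * ‖m‖) ^ 2
    rw [mul_pow, norm_sq, norm_sq]
    simp only [pairing, map_smul, star_smul, smul_mul_assoc, mul_smul_comm, norm_smul, norm_star]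
    ring
  norm_triangle m n := by
    refine le_of_sq_le_sq ?_ (add_nonneg (Real.sqrt_nonneg _) (Real.sqrt_nonneg _))
    rw [norm_sq]
    have e : pairing S (m + n) (m + n)
        = pairing S m m + pairing S m n + (pairing S n m + pairing S n n) := by
      simp only [pairing, map_add, star_add, add_mul, mul_add]
      abel
    rw [e]
    have h1 := norm_pairing_le S m n
    have h2 := norm_pairing_le S n m
    have h3 := norm_sq S m
    have h4 := norm_sq S n
    have h5 := norm_add_le (pairing S m m + pairing S m n) (pairing S n m + pairing S n n)
    have h6 := norm_add_le (pairing S m m) (pairing S m n)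
    have h7 := norm_add_le (pairing S n m) (pairing S n n)
    nlinarith

instance : SeminormedAddCommGroup S.PreModule :=
  SeminormedAddCommGroup.ofCore (core S)

instance : NormedSpace ℂ S.PreModule where
  norm_smul_le c m := ((core S).norm_smul c m).le

end PreModule

open UniformSpace (Completion)

/-- The Hilbert module `M_L`: the completion of `A_L`, modulo the vectors of seminorm zero. -/
abbrev ML : Type u := Completion S.PreModule

/-- The canonical map `q : A → M_L` with dense range. -/
def q : A →ₗ[ℂ] S.ML :=
  (Completion.toComplL (𝕜 := ℂ) (E := S.PreModule)).toLinearMap ∘ₗ (PreModule.of S).toLinearMap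

namespace PreModule

/-- The pairing as a bounded sesquilinear map. -/
def innerL : S.PreModule →L⋆[ℂ] S.PreModule →L[ℂ] A :=
  LinearMap.mkContinuous₂
    (LinearMap.mk₂'ₛₗ (starRingEnd ℂ) (RingHom.id ℂ) (pairing S)
      (fun m₁ m₂ n => by simp [pairing, add_mul])
      (fun c m n => by simp [pairing, smul_mul_assoc])
      (fun m n₁ n₂ => by simp [pairing, mul_add])
      (fun c m n => by simp [pairing, mul_smul_comm])) 1
    (fun m n => by rw [one_mul]; exact norm_pairing_le S m n)

/-- The right action `m · a = m α(a)` on `A_L`. -/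
def ractL : S.PreModule →L[ℂ] A →L[ℂ] S.PreModule :=
  LinearMap.mkContinuous₂
    (LinearMap.mk₂ ℂ (fun m a => of S ((of S).symm m * S.α a))
      (fun m₁ m₂ n => by simp [add_mul])
      (fun c m n => by simp [smul_mul_assoc])
      (fun m n₁ n₂ => by simp [mul_add])
      (fun c m n => by simp [mul_smul_comm])) 1
    (fun m a => by
      refine le_of_sq_le_sq ?_ (by positivity)
      simp only [LinearMap.mk₂_apply, one_mul, mul_pow, norm_sq, pairing,
        LinearEquiv.symm_apply_apply]
      rw [S.L_star_mul_mul_α, star_mul, ← map_star S.α, mul_assoc, S.L_mul]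
      refine (norm_mul_le _ _).trans ?_
      refine (mul_le_mul_of_nonneg_right (norm_mul_le _ _) (norm_nonneg _)).trans_eq ?_
      rw [norm_star]
      ring)

/-- The left action `a · m = a m` on `A_L`. -/
def lactL : A →L[ℂ] S.PreModule →L[ℂ] S.PreModule :=
  LinearMap.mkContinuous₂
    (LinearMap.mk₂ ℂ (fun a m => of S (a * (of S).symm m))
      (fun m₁ m₂ n => by simp [add_mul])
      (fun c m n => by simp [smul_mul_assoc])
      (fun m n₁ n₂ => by simp [mul_add])
      (fun c m n => by simp [mul_smul_comm])) 1
    (fun a m => by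
      refine le_of_sq_le_sq ?_ (by positivity)
      simp only [LinearMap.mk₂_apply, one_mul, mul_pow, norm_sq]
      exact S.norm_L_mul_le _ _)

end PreModule

open PreModule

/-- The canonical map `A_L → M_L`. -/
abbrev j : S.PreModule →L[ℂ] S.ML := Completion.toComplL

/-- The `A`-valued inner product of `M_L`: `⟨q(m), q(n)⟩ = L (m* n)`. -/
def inner : S.ML →L⋆[ℂ] S.ML →L[ℂ] A :=
  ((((innerL S).extend S.j).flip).extend S.j).flip

/-- The right action on `M_L`: `q(m) · a = q(m α(a))`. -/
def ract : S.ML →L[ℂ] A →L[ℂ] S.ML :=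
  ((ContinuousLinearMap.compL ℂ A S.PreModule S.ML S.j).comp (ractL S)).extend S.j

/-- The left action on `M_L`: `φ(a) q(m) = q(a m)`. -/
def φ : A →L[ℂ] S.ML →L[ℂ] S.ML :=
  (((ContinuousLinearMap.compL ℂ S.PreModule S.PreModule S.ML S.j).comp
    (lactL S)).flip.extend S.j).flip

theorem dense_j : DenseRange S.j := Completion.denseRange_coe

theorem uniform_j : IsUniformInducing S.j := Completion.isUniformInducing_coe _

theorem inner_q (m n : A) : S.inner (S.q m) (S.q n) = S.L (star m * n) := by
  change S.inner (S.j (of S m)) (S.j (of S n)) = _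
  simp only [inner, ContinuousLinearMap.flip_apply,
    ContinuousLinearMap.extend_eq _ S.dense_j S.uniform_j]
  rfl

theorem ract_q (m a : A) : S.ract (S.q m) a = S.q (m * S.α a) := by
  change S.ract (S.j (of S m)) a = S.j (of S (m * S.α a))
  simp only [ract, ContinuousLinearMap.extend_eq _ S.dense_j S.uniform_j]
  rfl

theorem φ_q (a m : A) : S.φ a (S.q m) = S.q (a * m) := by
  change S.φ a (S.j (of S m)) = S.j (of S (a * m))
  simp only [φ, ContinuousLinearMap.flip_apply,
    ContinuousLinearMap.extend_eq _ S.dense_j S.uniform_j]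
  rfl

theorem norm_q_sq (m : A) : ‖S.q m‖ ^ 2 = ‖S.L (star m * m)‖ := by
  rw [show ‖S.q m‖ = ‖of S m‖ from Completion.norm_coe (of S m), PreModule.norm_sq]
  rfl

theorem induction_q {p : S.ML → Prop} (hc : IsClosed {x | p x})
    (h : ∀ m : A, p (S.q m)) (x : S.ML) : p x :=
  Completion.induction_on x hc fun m => h ((of S).symm m)

/-- Positive elements of a C*-algebra form a closed set. -/
theorem isClosed_pos : IsClosed {a : A | ∃ b, a = star b * b} := by
  let _ : PartialOrder A := CStarAlgebra.spectralOrder A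
  have _ : StarOrderedRing A := CStarAlgebra.spectralOrderedRing A
  have : {a : A | ∃ b, a = star b * b} = {a : A | 0 ≤ a} := by
    ext a; exact CStarAlgebra.nonneg_iff_eq_star_mul_self.symm
  rw [this]
  exact CStarAlgebra.isClosed_nonneg

/-- The Hilbert bimodule `M_L` over `A`. -/
def bimodule : HilbertBimodule A S.ML where
  inner := S.inner
  ract := S.ract
  φ := S.φ
  ract_mul x a b := by
    induction x using S.induction_q with
    | hc => exact isClosed_eq (by fun_prop) (by fun_prop)
    | h m =>
      simp only [ract_q, map_mul, mul_assoc]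
  inner_ract x y a := by
    induction x using S.induction_q with
    | hc => exact isClosed_eq (by fun_prop) (by fun_prop)
    | h m =>
      induction y using S.induction_q with
      | hc => exact isClosed_eq (by fun_prop) (by fun_prop)
      | h n =>
        simp only [ract_q, inner_q, L_star_mul_mul_α]
  star_inner x y := by
    induction x using S.induction_q with
    | hc => exact isClosed_eq (by fun_prop) (by fun_prop)
    | h m =>
      induction y using S.induction_q with
      | hc => exact isClosed_eq (by fun_prop) (by fun_prop)
      | h n =>
        simp only [inner_q, star_L_star_mul]
  inner_self_pos x := by
    induction x using S.induction_q with
    | hc => exact (isClosed_pos (A := A)).preimage (f := fun x => S.inner x x) (by fun_prop)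
    | h m => rw [inner_q]; exact S.L_pos m
  norm_sq x := by
    induction x using S.induction_q with
    | hc => exact isClosed_eq (by fun_prop) (by fun_prop)
    | h m =>
      rw [inner_q, norm_q_sq]
  φ_mul a b x := by
    induction x using S.induction_q with
    | hc => exact isClosed_eq (by fun_prop) (by fun_prop)
    | h m =>
      simp only [φ_q, mul_assoc]
  inner_φ a x y := by
    induction x using S.induction_q with
    | hc => exact isClosed_eq (by fun_prop) (by fun_prop)
    | h m =>
      induction y using S.induction_q with
      | hc => exact isClosed_eq (by fun_prop) (by fun_prop)
      | h n =>
        simp only [φ_q, inner_q, star_mul, mul_assoc]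


open scoped MultiplierAlgebra

/-- A Toeplitz-covariant representation `(π, V)` in a C*-algebra `B`: a nondegenerate homomorphism
`π : A → B` and an element `V` of the multiplier algebra of `B` with `V π(a) = π(α(a)) V` and
`V* π(a) V = π(L(a))`. -/
structure ToeplitzCovariantRep (B : Type*) [NonUnitalCStarAlgebra B] where
  π : A →⋆ₙₐ[ℂ] B
  nondegenerate : (Submodule.span ℂ {x | ∃ a b, x = π a * b}).topologicalClosure = ⊤
  V : 𝓜(ℂ, B)
  V_mul : ∀ a, V * (π a : 𝓜(ℂ, B)) = (π (S.α a) : 𝓜(ℂ, B)) * V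
  star_V_mul : ∀ a, star V * (π a : 𝓜(ℂ, B)) * V = (π (S.L a) : 𝓜(ℂ, B))

namespace ToeplitzCovariantRep

variable {S} {B : Type*} [NonUnitalCStarAlgebra B] (R : S.ToeplitzCovariantRep B)

/-- The element `π(a)V` of `B`: the value of the right multiplication by `V` at `π(a)`. -/
def πV (a : A) : B := R.V.snd (R.π a)

theorem coe_injective {b c : B} (h : (b : 𝓜(ℂ, B)) = c) : b = c := by
  have h1 : b * star (b - c) = c * star (b - c) := congrArg (fun m => m.fst (star (b - c))) h
  rw [← sub_eq_zero, ← CStarRing.mul_star_self_eq_zero_iff, sub_mul, h1, sub_self]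

theorem coe_πV (a : A) : (R.πV a : 𝓜(ℂ, B)) = (R.π a : 𝓜(ℂ, B)) * R.V := by
  refine DoubleCentralizer.ext _ _ _ _ (Prod.ext ?_ ?_)
  · ext x
    exact R.V.central (R.π a) x
  · ext x
    have h : ∀ y, (x * R.V.snd (R.π a)) * y = R.V.snd (x * R.π a) * y := fun y => by
      rw [mul_assoc, R.V.central, R.V.central, mul_assoc]
    change x * R.V.snd (R.π a) = R.V.snd (x * R.π a)
    rw [← sub_eq_zero, ← CStarRing.mul_star_self_eq_zero_iff, sub_mul, h, sub_self]

theorem star_πV_mul (a b : A) : star (R.πV a) * R.πV b = R.π (S.L (star a * b)) := by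
  have cmul : ∀ b c : B, ((b * c : B) : 𝓜(ℂ, B)) = b * c :=
    map_mul (DoubleCentralizer.coeHom (𝕜 := ℂ) (A := B))
  have cstar : ∀ b : B, ((star b : B) : 𝓜(ℂ, B)) = star (b : 𝓜(ℂ, B)) :=
    map_star (DoubleCentralizer.coeHom (𝕜 := ℂ) (A := B))
  refine coe_injective ?_
  rw [← R.star_V_mul, cmul, cstar, R.coe_πV, R.coe_πV, star_mul, map_mul, map_star, cmul, cstar]
  simp only [mul_assoc]

theorem norm_πV_sq_le (a : A) : ‖R.πV a‖ ^ 2 ≤ ‖S.L (star a * a)‖ := by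
  rw [sq, ← CStarRing.norm_star_mul_self, star_πV_mul]
  exact NonUnitalStarAlgHom.norm_apply_le R.π _

end ToeplitzCovariantRep

/-- The Toeplitz-covariant representations in C*-algebras of the universe of `A`. This universe is
large enough to give the universal representation. -/
structure CovariantRepIndex : Type (u + 1) where
  B : Type u
  [instB : NonUnitalCStarAlgebra B]
  rep : S.ToeplitzCovariantRep B

attribute [instance] CovariantRepIndex.instB

/-- The `ℓ^∞`-product of the target algebras of all Toeplitz-covariant representations. -/
abbrev RepProduct : Type (u + 1) := lp (fun R : S.CovariantRepIndex => R.B) ∞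

/-- The product of the homomorphisms `π` over all representations. -/
def pi_i : A →⋆ₙₐ[ℂ] S.RepProduct := piHom fun R => R.rep.π

/-- The product of the elements `π(a)V` over all representations. -/
def pi_iS (a : A) : S.RepProduct :=
  ⟨fun R => R.rep.πV a, memℓp_infty ⟨√‖S.L (star a * a)‖, by
    rintro _ ⟨R, rfl⟩
    exact Real.le_sqrt_of_sq_le (R.rep.norm_πV_sq_le a)⟩⟩

/-- The C*-subalgebra generated by the elements `i(a)` and `i(a)S`. -/
def toeplitz : NonUnitalStarSubalgebra ℂ S.RepProduct :=
  (NonUnitalStarAlgebra.adjoin ℂ (Set.range S.pi_i ∪ Set.range S.pi_iS)).topologicalClosure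

instance : IsClosed (S.toeplitz : Set S.RepProduct) :=
  NonUnitalStarSubalgebra.isClosed_topologicalClosure _

/-- The Toeplitz crossed product `T(A, α, L)`: the C*-algebra generated by `i(A) ∪ i(A)S` for a
universal Toeplitz-covariant representation `(i, S)`. -/
abbrev Toeplitz : Type (u + 1) := S.toeplitz

/-- The canonical homomorphism `i : A → T(A, α, L)`. -/
def i : A →⋆ₙₐ[ℂ] S.Toeplitz :=
  NonUnitalStarAlgHom.codRestrict S.pi_i S.toeplitz fun a =>
    NonUnitalStarSubalgebra.le_topologicalClosure _
      (NonUnitalStarAlgebra.subset_adjoin ℂ _ (Or.inl ⟨a, rfl⟩))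

/-- The element `i(a)S` of `T(A, α, L)`. -/
def iS (a : A) : S.Toeplitz :=
  ⟨S.pi_iS a, NonUnitalStarSubalgebra.le_topologicalClosure _
    (NonUnitalStarAlgebra.subset_adjoin ℂ _ (Or.inr ⟨a, rfl⟩))⟩

/-- Every Toeplitz-covariant representation factors through the universal one. -/
theorem exists_lift {B : Type u} [NonUnitalCStarAlgebra B] (R : S.ToeplitzCovariantRep B) :
    ∃ ρ : S.Toeplitz →⋆ₙₐ[ℂ] B, (∀ a, ρ (S.i a) = R.π a) ∧ ∀ a, ρ (S.iS a) = R.πV a :=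
  ⟨(evalHom (⟨B, R⟩ : S.CovariantRepIndex)).comp
    (NonUnitalStarSubalgebraClass.subtype S.toeplitz), fun _ => rfl, fun _ => rfl⟩

/-- `(i(a), k)` is a redundancy: `k` is in the closed linear span `i(A)SS*i(A)` of the elements
`i(b)S (i(c)S)*`, and `i(a) i(b)S = k i(b)S` for all `b`. -/
def IsRedundancy (a : A) (k : S.Toeplitz) : Prop :=
  k ∈ (Submodule.span ℂ {x | ∃ b c, x = S.iS b * star (S.iS c)}).topologicalClosure ∧
    ∀ b, S.i a * S.iS b = k * S.iS b

/-- The closed linear span of `A α(A) A`. -/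
def AαA : Submodule ℂ A :=
  (Submodule.span ℂ {x | ∃ a b c, x = a * S.α b * c}).topologicalClosure

/-- The closed ideal generated by the `i(a) - k` for the redundancies `(i(a), k)` with `a` in the
closed span of `A α(A) A`. -/
def redundancyIdeal : ClosedIdeal S.Toeplitz :=
  ClosedIdeal.generate {x | ∃ a k, a ∈ S.AαA ∧ S.IsRedundancy a k ∧ x = S.i a - k}

/-- The crossed product of `A` by `α` and `L`: the quotient of `T(A, α, L)` by this ideal. -/
abbrev CrossedProduct : Type (u + 1) := S.redundancyIdeal.Quotient

/-- The quotient map `Q` of `T(A, α, L)` onto the crossed product. -/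
def Q : S.Toeplitz →⋆ₙₐ[ℂ] S.CrossedProduct := S.redundancyIdeal.mkHom

/-- The canonical homomorphism `Q ∘ i` of `A` into the crossed product. -/
def crossedProductHom : A →⋆ₙₐ[ℂ] S.CrossedProduct := S.Q.comp S.i

end TransferSystem

/-- A proper local homeomorphism `τ` of `T`, where proper means that the inverse images of compact
sets are compact. It is a classical system when `T` is a locally compact Hausdorff space. -/
structure ClassicalSystem (T : Type u) [TopologicalSpace T] where
  τ : T → T
  isLocalHomeomorph : IsLocalHomeomorph τ
  isCompact_preimage : ∀ K : Set T, IsCompact K → IsCompact (τ ⁻¹' K)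

namespace ClassicalSystem

variable {T : Type u} [TopologicalSpace T] (D : ClassicalSystem T)

theorem tendsto_cocompact : Filter.Tendsto D.τ (Filter.cocompact T) (Filter.cocompact T) := by
  rw [Filter.hasBasis_cocompact.tendsto_right_iff]
  exact fun K hK => (D.isCompact_preimage K hK).compl_mem_cocompact

theorem finite_fiber (t : T) : (D.τ ⁻¹' {t}).Finite :=
  (D.isCompact_preimage _ isCompact_singleton).finite
    (IsDiscrete.of_openPartialHomeomorph D.τ subset_rfl fun e _ => by
      obtain ⟨φ, hφ, h⟩ := D.isLocalHomeomorph e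
      exact ⟨φ, hφ, h.symm⟩)

/-- The average of `f` over the (finite) fibre of `t`, and `0` if the fibre is empty. -/
def avg (f : T → ℂ) (t : T) : ℂ :=
  (Nat.card (D.τ ⁻¹' {t}) : ℂ)⁻¹ * ∑ᶠ s ∈ D.τ ⁻¹' {t}, f s

theorem continuousAt_avg_of_evenly {f : T → ℂ} (hf : Continuous f) {t : T} {I : Type u}
    [TopologicalSpace I] [Fintype I] {U : Set T} (htU : t ∈ U) (hU : IsOpen U)
    (H : D.τ ⁻¹' U ≃ₜ U × I) (hH : ∀ x, (H x).1.1 = D.τ x) : ContinuousAt (D.avg f) t := by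
  -- for `u ∈ U` the fibre over `u` is parametrised by `I`
  let e : ∀ u : U, I ≃ (D.τ ⁻¹' {(u : T)} : Set T) := fun u =>
    { toFun := fun j => ⟨H.symm (u, j), by
        have := hH (H.symm (u, j))
        rw [Homeomorph.apply_symm_apply] at this
        exact this.symm⟩
      invFun := fun s => (H ⟨s, by
        have : D.τ s = u := s.2
        change D.τ s ∈ U
        rw [this]; exact u.2⟩).2
      left_inv := fun j => by simp
      right_inv := fun s => by
        have hs : D.τ s = u := s.2
        have hsU : D.τ s ∈ U := by rw [hs]; exact u.2
        have h1 : H ⟨s, hsU⟩ = (u, (H ⟨s, hsU⟩).2) :=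
          Prod.ext (Subtype.ext ((hH ⟨s, hsU⟩).trans hs)) rfl
        have h2 : H.symm (u, (H ⟨s, hsU⟩).2) = ⟨s, hsU⟩ := by
          rw [Homeomorph.symm_apply_eq]; exact h1.symm
        exact Subtype.ext (show ((H.symm (u, (H ⟨s, hsU⟩).2) : _) : T) = s by rw [h2]) }
  have hval : ∀ u : U, D.avg f u = (Nat.card I : ℂ)⁻¹ * ∑ j : I, f (H.symm (u, j)) := by
    intro u
    rw [avg, ← Nat.card_congr (e u), ← finsum_eq_sum_of_fintype,
      ← finsum_set_coe_eq_finsum_mem, ← finsum_comp_equiv (e u)]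
    rfl
  have hcont : ContinuousOn (D.avg f) U := by
    rw [continuousOn_iff_continuous_domRestrict]
    have : U.domRestrict (D.avg f)
        = fun u : U => (Nat.card I : ℂ)⁻¹ * ∑ j : I, f (H.symm (u, j)) := funext hval
    rw [this]
    fun_prop
  exact hcont.continuousAt (hU.mem_nhds htU)

theorem norm_avg_le {f : T → ℂ} {c : ℝ} (hc : 0 ≤ c) {t : T}
    (h : ∀ s, D.τ s = t → ‖f s‖ ≤ c) : ‖D.avg f t‖ ≤ c := by
  have hfin := D.finite_fiber t
  rw [avg, finsum_mem_eq_finite_toFinset_sum _ hfin, norm_mul, norm_inv, Complex.norm_natCast,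
    Nat.card_coe_set_eq, Set.ncard_eq_toFinset_card _ hfin]
  have h1 : ‖∑ s ∈ hfin.toFinset, f s‖ ≤ hfin.toFinset.card * c := by
    refine (norm_sum_le _ _).trans ?_
    rw [← nsmul_eq_mul]
    exact Finset.sum_le_card_nsmul _ _ _ fun s hs => h s (by simpa using hs)
  rcases Nat.eq_zero_or_pos hfin.toFinset.card with h0 | h0
  · rw [h0]; simpa using hc
  · have : (0 : ℝ) < hfin.toFinset.card := by exact_mod_cast h0
    rw [inv_mul_le_iff₀ this]
    exact h1

/-- Elements of `C₀(T)` are uniformly small outside compact sets. -/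
theorem exists_compact (f : C₀(T, ℂ)) {ε : ℝ} (hε : 0 < ε) :
    ∃ K : Set T, IsCompact K ∧ ∀ s ∉ K, ‖f s‖ ≤ ε := by
  have h := f.zero_at_infty' (Metric.closedBall_mem_nhds (0 : ℂ) hε)
  obtain ⟨K, hK, hKs⟩ := Filter.mem_cocompact.mp h
  exact ⟨K, hK, fun s hs => by simpa using hKs hs⟩

/-- The endomorphism `α : f ↦ f ∘ τ` of `C₀(T)`. -/
def α : C₀(T, ℂ) →⋆ₙₐ[ℂ] C₀(T, ℂ) where
  toFun f :=
    { toFun := fun t => f (D.τ t)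
      continuous_toFun := f.continuous.comp D.isLocalHomeomorph.continuous
      zero_at_infty' := f.zero_at_infty'.comp D.tendsto_cocompact }
  map_smul' _ _ := rfl
  map_zero' := rfl
  map_add' _ _ := rfl
  map_mul' _ _ := rfl
  map_star' _ := rfl

variable [T2Space T] [LocallyCompactSpace T]

theorem isProperMap : IsProperMap D.τ :=
  isProperMap_iff_isCompact_preimage.mpr ⟨D.isLocalHomeomorph.continuous,
    fun {K} hK => D.isCompact_preimage K hK⟩

theorem continuous_avg {f : T → ℂ} (hf : Continuous f) : Continuous (D.avg f) := by
  rw [continuous_iff_continuousAt]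
  intro t
  obtain ⟨-, U, htU, hU, -, H, hH⟩ : IsEvenlyCovered D.τ t (D.τ ⁻¹' {t}) :=
    D.isProperMap.isClosedMap.isEvenlyCovered_of_openPartialHomeomorph (D.finite_fiber t)
      fun e _ => by
        obtain ⟨φ, hφ, h⟩ := D.isLocalHomeomorph e
        exact ⟨φ, hφ, h.symm⟩
  have _ : Finite (D.τ ⁻¹' {t}) := D.finite_fiber t
  have _ := Fintype.ofFinite (D.τ ⁻¹' {t})
  exact D.continuousAt_avg_of_evenly hf htU hU H hH

/-- Averaging over fibres as a map of `C₀(T)` into itself. -/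
def avgC₀ (f : C₀(T, ℂ)) : C₀(T, ℂ) where
  toFun := D.avg f
  continuous_toFun := D.continuous_avg f.continuous
  zero_at_infty' := by
    rw [Metric.tendsto_nhds]
    intro ε hε
    obtain ⟨K, hK, hKs⟩ := exists_compact f (half_pos hε)
    filter_upwards [(hK.image D.isLocalHomeomorph.continuous).compl_mem_cocompact] with t ht
    rw [dist_zero_right]
    refine (D.norm_avg_le (half_pos hε).le fun s hs => hKs s fun hsK => ht ⟨s, hsK, hs⟩).trans_lt ?_
    linarith

/-- The transfer operator of `C₀(T)`: `L(f)(t)` is the average of `f` over the fibre `τ⁻¹(t)`. -/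
def L : C₀(T, ℂ) →L[ℂ] C₀(T, ℂ) :=
  LinearMap.mkContinuous
    { toFun := D.avgC₀
      map_add' := fun f g => by
        ext t
        change D.avg (fun s => f s + g s) t = D.avg f t + D.avg g t
        simp only [avg]
        rw [finsum_mem_add_distrib (D.finite_fiber t), mul_add]
      map_smul' := fun c f => by
        ext t
        change D.avg (fun s => c * f s) t = c * D.avg f t
        simp only [avg, finsum_mem_eq_finite_toFinset_sum _ (D.finite_fiber t)]
        rw [← Finset.mul_sum, mul_left_comm] } 1
    fun f => by
      rw [one_mul, ← ZeroAtInftyContinuousMap.norm_toBCF_eq_norm,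
        BoundedContinuousFunction.norm_le (norm_nonneg f)]
      intro t
      refine D.norm_avg_le (norm_nonneg f) fun s _ => ?_
      rw [← ZeroAtInftyContinuousMap.norm_toBCF_eq_norm]
      exact f.toBCF.norm_coe_le_norm s

theorem L_apply (f : C₀(T, ℂ)) (t : T) :
    D.L f t = (Nat.card (D.τ ⁻¹' {t}) : ℂ)⁻¹ * ∑ᶠ s ∈ D.τ ⁻¹' {t}, f s := rfl

theorem L_star_mul_self_apply (f : C₀(T, ℂ)) (t : T) :
    D.L (star f * f) t = (((Nat.card (D.τ ⁻¹' {t}) : ℝ)⁻¹ * ∑ᶠ s ∈ D.τ ⁻¹' {t}, ‖f s‖ ^ 2 : ℝ) : ℂ) := by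
  rw [L_apply, finsum_mem_eq_finite_toFinset_sum _ (D.finite_fiber t),
    finsum_mem_eq_finite_toFinset_sum _ (D.finite_fiber t)]
  push_cast
  congr 1
  refine Finset.sum_congr rfl fun s _ => ?_
  change star (f s) * f s = _
  rw [Complex.star_def, Complex.conj_mul']

/-- The function `√|f|` in `C₀(T)`. -/
def sqrtC₀ (f : C₀(T, ℂ)) : C₀(T, ℂ) where
  toFun t := (√‖f t‖ : ℝ)
  continuous_toFun := by
    have := f.continuous
    fun_prop
  zero_at_infty' := by
    have h1 : Continuous fun z : ℂ => ((√‖z‖ : ℝ) : ℂ) := by fun_prop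
    have h2 := (h1.tendsto 0).comp f.zero_at_infty'
    simpa [Function.comp_def] using h2

/-- The algebra `C₀(T)` with `α : f ↦ f ∘ τ` and the averaging transfer operator `L`. -/
def transferSystem : TransferSystem C₀(T, ℂ) where
  α := D.α
  L := D.L
  L_pos f := by
    refine ⟨sqrtC₀ (D.L (star f * f)), ?_⟩
    ext t
    change _ = star ((√‖D.L (star f * f) t‖ : ℝ) : ℂ) * ((√‖D.L (star f * f) t‖ : ℝ) : ℂ)
    have hs : (0 : ℝ) ≤ ∑ᶠ s ∈ D.τ ⁻¹' {t}, ‖f s‖ ^ 2 := by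
      rw [finsum_mem_eq_finite_toFinset_sum _ (D.finite_fiber t)]
      exact Finset.sum_nonneg fun s _ => by positivity
    have h0 : (0 : ℝ) ≤ (Nat.card (D.τ ⁻¹' {t}) : ℝ)⁻¹ * ∑ᶠ s ∈ D.τ ⁻¹' {t}, ‖f s‖ ^ 2 :=
      mul_nonneg (by positivity) hs
    rw [Complex.star_def, Complex.conj_ofReal, ← Complex.ofReal_mul,
      Real.mul_self_sqrt (norm_nonneg _), L_star_mul_self_apply, Complex.norm_real,
      Real.norm_of_nonneg h0]
  L_mul f g := by
    ext t
    change D.avg (fun s => f (D.τ s) * g s) t = f t * D.avg g t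
    simp only [avg, finsum_mem_eq_finite_toFinset_sum _ (D.finite_fiber t)]
    rw [mul_left_comm, Finset.mul_sum _ _ (f t)]
    congr 1
    refine Finset.sum_congr rfl fun s hs => ?_
    rw [show D.τ s = t by simpa using hs]

end ClassicalSystem
end ExelCrossedProduct

end

/-! ### Homomorphisms of C*-algebras and generated ideals -/

noncomputable section

namespace ExelCrossedProduct

open scoped MultiplierAlgebra

/-! Both algebras impose relations of one kind: `π(a)` is identified with an element `k` that has
the same effect as `π(a)` when multiplied from the left onto the elements `ψ(x)`, respectively
`i(b)S`. In a representation where only `0` annihilates all these elements from the left, such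
relations hold automatically. So it suffices to find one covariant pair `(π, v)` with `π` faithful
such that `b π(a) v = 0` for all `a` forces `b = 0`: it factors through both algebras, and
faithfulness of `π` passes to the canonical maps (`injective_of_pair`, resting on
`isCoisometricOn_J` and `map_eq_zero_of_mem_generate`).

Such a pair lives on `ℓ²(T)`. Let `π(f)` be multiplication by `f` and `(Vξ)(x) = |τ⁻¹(τ(x))|^(-1/2)
ξ(τ(x))`. Then `V π(f) = π(f ∘ τ) V`, and in `V* π(f) V` the squared weights turn the sum of `f`
over a fibre into its average, which gives `π(L(f))` (`star_V_mul_mulRep_mul_V`). If `f` is `1` at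
`x` and `0` at the finitely many other points of its fibre, then `π(f) V δ_{τ(x)}` is a nonzero
multiple of `δ_x`, so the ranges of the `π(f)V` span a dense subspace
(`eq_zero_of_mul_mulRep_mul_V`). Each `x` lies in the fibre over `τ(x)`, so surjectivity of `τ`
plays no role.

One technical point remains. A Toeplitz-covariant representation in `B` needs `π(A)B` to span a
dense subspace of `B`, which can fail for `B` the algebra of all bounded operators. The pair is
therefore cut down to the hereditary subalgebra generated by `π(A)`; `V` is a multiplier of it
because `α` is nondegenerate (`covariantRepOfPair`). -/

theorem continuous_starHom {B C : Type*} [NonUnitalCStarAlgebra B] [NonUnitalCStarAlgebra C]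
    (ρ : B →⋆ₙₐ[ℂ] C) : Continuous ρ :=
  AddMonoidHomClass.continuous_of_bound ρ 1 fun b => by
    rw [one_mul]; exact NonUnitalStarAlgHom.norm_apply_le ρ b

namespace ClosedIdeal

variable {B : Type*} [NonUnitalCStarAlgebra B]

/-- The ideal generated by `s` is contained in the kernel of every homomorphism vanishing on `s`. -/
theorem map_eq_zero_of_mem_generate {C : Type*} [NonUnitalCStarAlgebra C] (ρ : B →⋆ₙₐ[ℂ] C)
    {s : Set B} (hs : ∀ x ∈ s, ρ x = 0) {x : B} (hx : x ∈ (generate s).toSubmodule) :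
    ρ x = 0 := by
  have hcont : Continuous ρ := continuous_starHom ρ
  refine Submodule.mem_sInf.mp hx (LinearMap.ker (ρ : B →ₗ[ℂ] C)) ⟨?_, fun b y hy => ?_, hs⟩
  · exact isClosed_singleton.preimage hcont
  · replace hy : ρ y = 0 := hy
    exact ⟨show ρ (b * y) = 0 by rw [map_mul, hy, mul_zero],
      show ρ (y * b) = 0 by rw [map_mul, hy, zero_mul]⟩

end ClosedIdeal

/-! ### Compact operators in a Toeplitz representation -/

namespace HilbertBimodule

variable {A M : Type u} [NonUnitalCStarAlgebra A] [NormedAddCommGroup M]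
    [NormedSpace ℂ M] [CompleteSpace M] {X : HilbertBimodule A M}
    {B : Type*} [NonUnitalCStarAlgebra B] (R : X.ToeplitzRep B)

theorem ToeplitzRep.continuous_ψ : Continuous R.ψ :=
  AddMonoidHomClass.continuous_of_bound R.ψ 1 fun x => by rw [one_mul]; exact R.norm_ψ_le x

/-- On `Θ x y` this is `ψ(x) ψ(y)* ψ(z) = ψ(x) π(⟨y, z⟩) = ψ(x · ⟨y, z⟩)`; linearity and continuity
in `F` give the rest. It allows `(ψ, π)⁽¹⁾(φ(a))` to be compared with `π(a)`, since both implement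
`φ(a)` on the range of `ψ`. -/
theorem ToeplitzRep.one_mul_ψ (F : X.compacts) (z : M) :
    R.one F * R.ψ z = R.ψ ((F : M →L[ℂ] M) z) := by
  obtain ⟨F, hF⟩ := F
  have hclosed : IsClosed {F : X.compacts | R.one F * R.ψ z = R.ψ ((F : M →L[ℂ] M) z)} := by
    refine isClosed_eq (by fun_prop) (R.continuous_ψ.comp ?_)
    fun_prop
  -- Membership in `X.compacts` is quantified inside the claim, so that the induction over the span
  -- can apply the hypothesis to each summand as an element of the subtype.
  have hspan : ∀ G ∈ Submodule.span ℂ {F | ∃ x y, F = X.Θ x y}, ∀ hG : G ∈ X.compacts,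
      R.one ⟨G, hG⟩ * R.ψ z = R.ψ (G z) := by
    intro G hG
    induction hG using Submodule.span_induction with
    | mem G hG =>
      obtain ⟨x, y, rfl⟩ := hG
      intro _
      rw [R.one_Θ, mul_assoc, R.star_ψ_mul, ← R.ψ_ract]
      rfl
    | zero =>
      intro h
      rw [show (⟨0, h⟩ : X.compacts) = 0 from rfl]
      simp
    | add G H hG hH ihG ihH =>
      intro h
      have hG' : G ∈ X.compacts := Submodule.le_topologicalClosure _ hG
      have hH' : H ∈ X.compacts := Submodule.le_topologicalClosure _ hH
      rw [show (⟨G + H, h⟩ : X.compacts) = ⟨G, hG'⟩ + ⟨H, hH'⟩ from rfl, map_add, add_mul,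
        ihG, ihH, add_apply, map_add]
    | smul c G hG ihG =>
      intro h
      have hG' : G ∈ X.compacts := Submodule.le_topologicalClosure _ hG
      rw [show (⟨c • G, h⟩ : X.compacts) = c • ⟨G, hG'⟩ from rfl, map_smul, smul_mul_assoc,
        ihG, smul_apply, map_smul]
  -- `compacts` is a closure taken in all operators; `closure_subtype` transfers the density of the
  -- span to the subspace topology.
  have hdense : (⟨F, hF⟩ : X.compacts) ∈ closure
      {G : X.compacts | (G : M →L[ℂ] M) ∈ Submodule.span ℂ {F | ∃ x y, F = X.Θ x y}} := by
    rw [closure_subtype]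
    refine closure_mono (fun G hG => ?_) hF
    exact ⟨⟨G, Submodule.le_topologicalClosure _ hG⟩, hG, rfl⟩
  refine closure_minimal (fun G hG => ?_) hclosed hdense
  exact hspan _ hG (Subtype.mem G)

/-- A Toeplitz representation is coisometric on `J(M)` if only `0` annihilates the range of `ψ`. -/
theorem ToeplitzRep.isCoisometricOn_J (h : ∀ b : B, (∀ z, b * R.ψ z = 0) → b = 0) :
    R.IsCoisometricOn X.J := by
  refine fun a ha => ⟨ha, ?_⟩
  rw [← sub_eq_zero]
  -- The difference `(ψ, π)⁽¹⁾(φ(a)) - π(a)` sends `ψ(z)` to `ψ(φ(a)z) - ψ(φ(a)z) = 0`.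
  refine h _ fun z => ?_
  rw [sub_mul, R.one_mul_ψ, R.ψ_φ, sub_self]

end HilbertBimodule

/-! ### From a covariant representation to the two universal algebras -/

namespace TransferSystem

variable {A : Type u} [NonUnitalCStarAlgebra A] {S : TransferSystem A}

namespace ToeplitzCovariantRep

variable {B : Type*} [NonUnitalCStarAlgebra B] (R : S.ToeplitzCovariantRep B)

theorem π_mul_πV (a m : A) : R.π a * R.πV m = R.πV (a * m) := by
  refine coe_injective ?_
  have cmul : ∀ b c : B, ((b * c : B) : 𝓜(ℂ, B)) = b * c :=
    map_mul (DoubleCentralizer.coeHom (𝕜 := ℂ) (A := B))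
  rw [cmul, coe_πV, coe_πV, map_mul, cmul, mul_assoc]

/-- This is the relation `V π(a) = π(α(a)) V` multiplied by `π(m)`. It can be checked among
multipliers, where `πV m` is an honest product and into which `B` embeds. -/
theorem πV_mul_π (m a : A) : R.πV m * R.π a = R.πV (m * S.α a) := by
  refine coe_injective ?_
  have cmul : ∀ b c : B, ((b * c : B) : 𝓜(ℂ, B)) = b * c :=
    map_mul (DoubleCentralizer.coeHom (𝕜 := ℂ) (A := B))
  rw [cmul, coe_πV, coe_πV, map_mul, cmul, mul_assoc, mul_assoc, R.V_mul]

/-- The map `m ↦ π(m)V`, bounded for the seminorm of `A_L`. -/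
def πVL : S.PreModule →L[ℂ] B :=
  LinearMap.mkContinuous
    { toFun := fun m => R.πV ((PreModule.of S).symm m)
      map_add' := fun m n => by simp [πV]
      map_smul' := fun c m => by simp [πV] } 1
    fun m => by
      rw [one_mul]
      refine le_of_sq_le_sq ?_ (Real.sqrt_nonneg _)
      rw [PreModule.norm_sq]
      exact R.norm_πV_sq_le _

/-- The extension of `q(m) ↦ π(m)V` to the Hilbert module `M_L`. -/
def ψ : S.ML →L[ℂ] B := R.πVL.extend S.j

theorem ψ_q (m : A) : R.ψ (S.q m) = R.πV m :=
  ContinuousLinearMap.extend_eq _ S.dense_j S.uniform_j _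

/-- The Toeplitz representation of `M_L` with `ψ(q(m)) = π(m)V`. -/
def toToeplitzRep : S.bimodule.ToeplitzRep B where
  ψ := R.ψ
  π := R.π
  ψ_ract x a := by
    change R.ψ (S.ract x a) = R.ψ x * R.π a
    induction x using S.induction_q with
    | hc => exact isClosed_eq (by fun_prop) (by fun_prop)
    | h m => rw [ract_q, ψ_q, ψ_q, πV_mul_π]
  star_ψ_mul x y := by
    change star (R.ψ x) * R.ψ y = R.π (S.inner x y)
    have hπ : Continuous R.π := continuous_starHom R.π
    induction x using S.induction_q with
    | hc => exact isClosed_eq (by fun_prop) (hπ.comp (by fun_prop))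
    | h m =>
      induction y using S.induction_q with
      | hc => exact isClosed_eq (by fun_prop) (hπ.comp (by fun_prop))
      | h n => rw [inner_q, ψ_q, ψ_q, star_πV_mul]
  ψ_φ a x := by
    change R.ψ (S.φ a x) = R.π a * R.ψ x
    induction x using S.induction_q with
    | hc => exact isClosed_eq (by fun_prop) (by fun_prop)
    | h m => rw [φ_q, ψ_q, ψ_q, π_mul_πV]

end ToeplitzCovariantRep

variable {B : Type u} [NonUnitalCStarAlgebra B] (R : S.ToeplitzCovariantRep B)

/-- A faithful Toeplitz-covariant representation in which only `0` annihilates all `π(a)V` makes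
`A` embed in the Cuntz-Pimsner algebra. -/
theorem cuntzPimsnerHom_injective (hπ : Function.Injective R.π)
    (h : ∀ b : B, (∀ a, b * R.πV a = 0) → b = 0) :
    Function.Injective S.bimodule.cuntzPimsnerHom := by
  have hco : R.toToeplitzRep.IsCoisometricOn S.bimodule.J :=
    R.toToeplitzRep.isCoisometricOn_J fun b hb => h b fun a => by
      rw [← R.ψ_q]; exact hb (S.q a)
  -- The universal property ranges over target algebras in the universe of `A`, which is why `B` is
  -- taken there.
  obtain ⟨ρ, -, hρ⟩ := S.bimodule.exists_lift _ R.toToeplitzRep hco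
  refine fun a b hab => hπ ?_
  have : ρ (S.bimodule.kA S.bimodule.J a) = ρ (S.bimodule.kA S.bimodule.J b) := congrArg ρ hab
  rwa [hρ, hρ] at this

/-- A faithful Toeplitz-covariant representation in which only `0` annihilates all `π(a)V` makes
`A` embed in the crossed product. -/
theorem crossedProductHom_injective (hπ : Function.Injective R.π)
    (h : ∀ b : B, (∀ a, b * R.πV a = 0) → b = 0) :
    Function.Injective S.crossedProductHom := by
  obtain ⟨ρ, hρ, hρS⟩ := S.exists_lift R
  rw [injective_iff_map_eq_zero]
  intro a ha
  have hmem : S.i a ∈ S.redundancyIdeal.toSubmodule := (Submodule.Quotient.mk_eq_zero _).mp ha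
  have h0 : ρ (S.i a) = 0 := by
    refine ClosedIdeal.map_eq_zero_of_mem_generate ρ ?_ hmem
    rintro _ ⟨c, k, -, ⟨-, hk⟩, rfl⟩
    -- For a redundancy `(i(c), k)`, the element `i(c) - k` annihilates every `i(b)S`, so its image
    -- annihilates every `π(b)V` and vanishes.
    refine h _ fun b => ?_
    rw [← hρS, ← map_mul, sub_mul, hk, sub_self, map_zero]
  rw [hρ] at h0
  exact (injective_iff_map_eq_zero R.π).mp hπ a h0

end TransferSystem
end ExelCrossedProduct

end

/-! ### The hereditary subalgebra generated by a degenerate homomorphism -/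

noncomputable section

namespace ExelCrossedProduct

open scoped MultiplierAlgebra
open Filter Topology

/-- An element `v` of a C*-algebra that idealises a closed *-subalgebra, as a multiplier of it. -/
def multiplierOf {C : Type*} [NonUnitalCStarAlgebra C] (D : NonUnitalStarSubalgebra ℂ C)
    [IsClosed (D : Set C)] (v : C) (hl : ∀ b ∈ D, v * b ∈ D) (hr : ∀ b ∈ D, b * v ∈ D) :
    𝓜(ℂ, D) where
  fst := LinearMap.mkContinuous
    { toFun := fun b => ⟨v * b, hl b b.2⟩
      map_add' := fun b c => Subtype.ext (mul_add v b c)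
      map_smul' := fun c b => Subtype.ext (mul_smul_comm c v (b : C)) } ‖v‖
    fun b => norm_mul_le v b
  snd := LinearMap.mkContinuous
    { toFun := fun b => ⟨b * v, hr b b.2⟩
      map_add' := fun b c => Subtype.ext (add_mul (b : C) c v)
      map_smul' := fun c b => Subtype.ext (smul_mul_assoc c (b : C) v) } ‖v‖
    fun b => (norm_mul_le (b : C) v).trans_eq (mul_comm _ _)
  central b c := Subtype.ext (mul_assoc (b : C) v c)

/-- The algebra has an approximate unit, in a form that does not mention the order. -/
theorem exists_approximateUnit (A : Type*) [NonUnitalCStarAlgebra A] :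
    ∃ l : Filter A, l.NeBot ∧ (∀ a, Tendsto (fun e => e * a) l (𝓝 a)) ∧ ∀ᶠ e in l, ‖e‖ ≤ 1 := by
  let _ : PartialOrder A := CStarAlgebra.spectralOrder A
  have _ : StarOrderedRing A := CStarAlgebra.spectralOrderedRing A
  have h := CStarAlgebra.increasingApproximateUnit (A := A)
  exact ⟨_, h.neBot, h.tendsto_mul_right, h.eventually_norm⟩

variable {A C : Type*} [NonUnitalCStarAlgebra A] [NonUnitalCStarAlgebra C] (π : A →⋆ₙₐ[ℂ] C)

/-- The closed right ideal generated by the range of `π`. -/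
def rightIdeal : Submodule ℂ C :=
  (Submodule.span ℂ {x | ∃ a c, x = π a * c}).topologicalClosure

theorem isClosed_rightIdeal : IsClosed (rightIdeal π : Set C) :=
  Submodule.isClosed_topologicalClosure _

theorem mul_mem_rightIdeal (a : A) (c : C) : π a * c ∈ rightIdeal π :=
  Submodule.le_topologicalClosure _ (Submodule.subset_span ⟨a, c, rfl⟩)

/-- A continuous linear map that sends the generators `π(a)c` into the closed right ideal preserves
the ideal. -/
theorem map_mem_rightIdeal {f : C →L[ℂ] C} (hf : ∀ a c, f (π a * c) ∈ rightIdeal π) {b : C}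
    (hb : b ∈ rightIdeal π) : f b ∈ rightIdeal π := by
  have h : Submodule.span ℂ {x | ∃ a c, x = π a * c} ≤ (rightIdeal π).comap f.toLinearMap := by
    rw [Submodule.span_le]
    rintro _ ⟨a, c, rfl⟩
    exact hf a c
  exact Submodule.topologicalClosure_minimal _ h
    ((isClosed_rightIdeal π).preimage f.continuous) hb

theorem mul_right_mem_rightIdeal {b : C} (hb : b ∈ rightIdeal π) (c : C) :
    b * c ∈ rightIdeal π :=
  map_mem_rightIdeal π (f := (ContinuousLinearMap.mul ℂ C).flip c)
    (fun a d => by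
      change π a * d * c ∈ _
      rw [mul_assoc]
      exact mul_mem_rightIdeal π a _) hb

/-- The image of an approximate unit of `A` is a left approximate unit of the ideal: on generators
`π(e)π(a)c = π(ea)c → π(a)c`, and the bound `‖e‖ ≤ 1` carries this over to the closure. -/
theorem exists_norm_sub_lt {b : C} (hb : b ∈ rightIdeal π) {ε : ℝ} (hε : 0 < ε) :
    ∃ e : A, ‖b - π e * b‖ < ε := by
  obtain ⟨l, _, hl, hn⟩ := exists_approximateUnit A
  have hspan : ∀ y ∈ Submodule.span ℂ {x | ∃ a c, x = π a * c},
      Tendsto (fun e => π e * y) l (𝓝 y) := by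
    intro y hy
    induction hy using Submodule.span_induction with
    | mem y hy =>
      obtain ⟨a, c, rfl⟩ := hy
      have h := (((continuous_starHom π).tendsto a).comp (hl a)).mul_const c
      refine h.congr fun e => ?_
      rw [Function.comp_apply, map_mul, mul_assoc]
    | zero => simp
    | add y z _ _ h k => simpa only [mul_add] using h.add k
    | smul c y _ h => simpa only [mul_smul_comm] using h.const_smul c
  obtain ⟨y, hy, hby⟩ := Metric.mem_closure_iff.mp hb (ε / 3) (by positivity)
  obtain ⟨e, he, hen⟩ :=
    ((Metric.tendsto_nhds.mp (hspan y hy) (ε / 3) (by positivity)).and hn).exists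
  refine ⟨e, ?_⟩
  rw [dist_eq_norm] at hby he
  -- Each of the three terms has norm less than `ε / 3`, the last one because `‖π e‖ ≤ 1`.
  have h1 : b - π e * b = (b - y) - (π e * y - y) - π e * (b - y) := by noncomm_ring
  have h2 : ‖π e * (b - y)‖ ≤ 1 * ‖b - y‖ := by
    refine (norm_mul_le _ _).trans ?_
    gcongr
    exact (NonUnitalStarAlgHom.norm_apply_le π e).trans hen
  rw [h1]
  have h3 := norm_sub_le ((b - y) - (π e * y - y)) (π e * (b - y))
  have h4 := norm_sub_le (b - y) (π e * y - y)
  linarith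

theorem apply_mem_rightIdeal (a : A) : π a ∈ rightIdeal π := by
  obtain ⟨l, _, hl, -⟩ := exists_approximateUnit A
  have h := ((continuous_starHom π).tendsto a).comp (hl a)
  refine (isClosed_rightIdeal π).mem_of_tendsto h (Eventually.of_forall fun e => ?_)
  rw [Function.comp_apply, map_mul]
  exact mul_mem_rightIdeal π _ _

/-- The hereditary subalgebra generated by the range of `π`. -/
def hereditary : NonUnitalStarSubalgebra ℂ C where
  carrier := {b | b ∈ rightIdeal π ∧ star b ∈ rightIdeal π}
  zero_mem' := ⟨zero_mem _, by rw [star_zero]; exact zero_mem _⟩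
  add_mem' h k := ⟨add_mem h.1 k.1, by rw [star_add]; exact add_mem h.2 k.2⟩
  mul_mem' h k := ⟨mul_right_mem_rightIdeal π h.1 _, by
    rw [star_mul]; exact mul_right_mem_rightIdeal π k.2 _⟩
  smul_mem' c x h := ⟨Submodule.smul_mem _ c h.1, by
    rw [star_smul]; exact Submodule.smul_mem _ _ h.2⟩
  star_mem' h := ⟨h.2, by rw [star_star]; exact h.1⟩

instance : IsClosed (hereditary π : Set C) :=
  (isClosed_rightIdeal π).inter ((isClosed_rightIdeal π).preimage continuous_star)

theorem apply_mem_hereditary (a : A) : π a ∈ hereditary π :=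
  ⟨apply_mem_rightIdeal π a, by rw [← map_star]; exact apply_mem_rightIdeal π _⟩

/-- The homomorphism `π` as a map into the hereditary subalgebra that it generates. -/
def toHereditary : A →⋆ₙₐ[ℂ] hereditary π :=
  NonUnitalStarAlgHom.codRestrict π (hereditary π) (apply_mem_hereditary π)

/-- The elements `π(e)b` that approximate `b` are products inside the hereditary subalgebra, so the
approximation in `C` already takes place there. -/
theorem toHereditary_nondegenerate :
    (Submodule.span ℂ {x | ∃ a b, x = toHereditary π a * b}).topologicalClosure = ⊤ := by
  refine eq_top_iff.mpr fun b _ => Metric.mem_closure_iff.mpr fun ε hε => ?_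
  obtain ⟨e, he⟩ := exists_norm_sub_lt π b.2.1 hε
  refine ⟨toHereditary π e * b, Submodule.subset_span ⟨e, b, rfl⟩, ?_⟩
  rw [dist_eq_norm]
  exact he

/-! ### Covariant pairs in a C*-algebra -/

namespace TransferSystem

variable {A C : Type u} [NonUnitalCStarAlgebra A] [NonUnitalCStarAlgebra C] {S : TransferSystem A}
  (π : A →⋆ₙₐ[ℂ] C) (v : C)

/-- If `α` is nondegenerate, then `v* π(a)` is in the closed right ideal generated by `π`. -/
theorem star_mul_mem_rightIdeal (hα : ∀ a : A, ∀ ε : ℝ, 0 < ε → ∃ c, ‖a - S.α c * a‖ < ε)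
    (hv : ∀ a, v * π a = π (S.α a) * v) (a : A) : star v * π a ∈ rightIdeal π := by
  -- This is the adjoint of the covariance relation at `c*`.
  have hstar : ∀ c, star v * π (S.α c) = π c * star v := fun c => by
    have h := congrArg star (hv (star c))
    simp only [star_mul, map_star, star_star] at h
    exact h.symm
  refine (isClosed_rightIdeal π).closure_subset (Metric.mem_closure_iff.mpr fun ε hε => ?_)
  -- Since `α(c)a` is close to `a`, the element `v* π(a)` is close to `v* π(α(c)a) = π(c) v* π(a)`,
  -- which lies in the ideal. The `+ 1` keeps the denominator positive when `v = 0`.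
  obtain ⟨c, hc⟩ := hα a (ε / (‖v‖ + 1)) (by positivity)
  refine ⟨π c * (star v * π a), mul_mem_rightIdeal π _ _, ?_⟩
  have h : star v * π a - π c * (star v * π a) = star v * π (a - S.α c * a) := by
    rw [map_sub, map_mul, mul_sub, ← mul_assoc, ← mul_assoc, hstar]
  rw [dist_eq_norm, h]
  have h1 : ‖π (a - S.α c * a)‖ ≤ ε / (‖v‖ + 1) :=
    (NonUnitalStarAlgHom.norm_apply_le π _).trans hc.le
  calc ‖star v * π (a - S.α c * a)‖ ≤ ‖v‖ * (ε / (‖v‖ + 1)) := by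
        refine (norm_mul_le _ _).trans ?_
        rw [norm_star]
        gcongr
    _ < (‖v‖ + 1) * (ε / (‖v‖ + 1)) := by gcongr; linarith
    _ = ε := by field_simp

theorem mul_mem_rightIdeal_of_covariant (hv : ∀ a, v * π a = π (S.α a) * v) {b : C}
    (hb : b ∈ rightIdeal π) : v * b ∈ rightIdeal π :=
  map_mem_rightIdeal π (f := ContinuousLinearMap.mul ℂ C v)
    (fun a c => by
      change v * (π a * c) ∈ _
      rw [← mul_assoc, hv, mul_assoc]
      exact mul_mem_rightIdeal π _ _) hb

theorem star_mul_mem_rightIdeal_of_covariant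
    (hα : ∀ a : A, ∀ ε : ℝ, 0 < ε → ∃ c, ‖a - S.α c * a‖ < ε)
    (hv : ∀ a, v * π a = π (S.α a) * v) {b : C}
    (hb : b ∈ rightIdeal π) : star v * b ∈ rightIdeal π :=
  map_mem_rightIdeal π (f := ContinuousLinearMap.mul ℂ C (star v))
    (fun a c => by
      change star v * (π a * c) ∈ _
      rw [← mul_assoc]
      exact mul_right_mem_rightIdeal π (star_mul_mem_rightIdeal π v hα hv a) _) hb

/-- A pair `(π, v)` in a C*-algebra that satisfies the covariance relations, with `π` possibly
degenerate, gives a Toeplitz-covariant representation in the hereditary subalgebra generated by the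
range of `π`. -/
def covariantRepOfPair (hα : ∀ a : A, ∀ ε : ℝ, 0 < ε → ∃ c, ‖a - S.α c * a‖ < ε)
    (hv : ∀ a, v * π a = π (S.α a) * v) (hL : ∀ a, star v * π a * v = π (S.L a)) :
    S.ToeplitzCovariantRep (hereditary π) where
  π := toHereditary π
  nondegenerate := toHereditary_nondegenerate π
  V := multiplierOf (hereditary π) v
    (fun b hb => ⟨mul_mem_rightIdeal_of_covariant π v hv hb.1, by
      rw [star_mul]; exact mul_right_mem_rightIdeal π hb.2 _⟩)
    -- The adjoint of `bv` is `v* b*`; this is where nondegeneracy of `α` enters.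
    (fun b hb => ⟨mul_right_mem_rightIdeal π hb.1 _, by
      rw [star_mul]; exact star_mul_mem_rightIdeal_of_covariant π v hα hv hb.2⟩)
  V_mul a := by
    refine DoubleCentralizer.ext _ _ _ _ (Prod.ext ?_ ?_)
    · ext x
      change v * (π a * (x : C)) = π (S.α a) * (v * x)
      rw [← mul_assoc, hv, mul_assoc]
    · ext x
      change (x : C) * v * π a = x * π (S.α a) * v
      rw [mul_assoc, hv, mul_assoc]
  star_V_mul a := by
    refine DoubleCentralizer.ext _ _ _ _ (Prod.ext ?_ ?_)
    · ext x
      -- The adjoint of a multiplier acts on the left by `y ↦ (y* v)*`, which equals `v* y`; on the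
      -- right it acts by `y ↦ (v y*)*`.
      change star (star (π a * (v * (x : C))) * v) = π (S.L a) * x
      rw [← hL]
      simp only [star_mul, star_star, mul_assoc]
    · ext x
      change star (v * star (x : C)) * π a * v = x * π (S.L a)
      rw [← hL]
      simp only [star_mul, star_star, mul_assoc]

/-- A faithful covariant pair `(π, v)` in which only `0` annihilates all `π(a)v` makes `A` embed in
both the crossed product and the Cuntz-Pimsner algebra. -/
theorem injective_of_pair (hα : ∀ a : A, ∀ ε : ℝ, 0 < ε → ∃ c, ‖a - S.α c * a‖ < ε)
    (hv : ∀ a, v * π a = π (S.α a) * v) (hL : ∀ a, star v * π a * v = π (S.L a))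
    (hπ : Function.Injective π) (h : ∀ b : C, (∀ a, b * (π a * v) = 0) → b = 0) :
    Function.Injective S.crossedProductHom ∧ Function.Injective S.bimodule.cuntzPimsnerHom := by
  have hπ' : Function.Injective (covariantRepOfPair π v hα hv hL).π :=
    fun a b hab => hπ (congrArg Subtype.val hab)
  -- Inside the hereditary subalgebra `πV a` is by definition the element `π(a)v` of `C`, so the
  -- annihilator condition restricts to it.
  have h' : ∀ b : hereditary π, (∀ a, b * (covariantRepOfPair π v hα hv hL).πV a = 0) → b = 0 :=
    fun b hb => Subtype.ext (h b fun a => congrArg Subtype.val (hb a))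
  exact ⟨crossedProductHom_injective _ hπ' h', cuntzPimsnerHom_injective _ hπ' h'⟩

end TransferSystem
end ExelCrossedProduct

end

/-! ### Weighted composition and multiplication operators on `ℓ²(T)` -/

noncomputable section

namespace ExelCrossedProduct

open scoped lp

section WeightedComposition

variable {T : Type*} {σ : T → T} {w : T → ℂ} {c : ℝ}

-- Group the sum by the fibres of `σ`. On the part of `s` over `t` the factor `ξ(σ(x))` is the
-- constant `ξ(t)` and the squared weights add up to at most `c²`; what remains is a partial sum of
-- `c² ‖ξ‖²`.
open Classical in
theorem sum_norm_weighted_comp_le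
    (hw : ∀ (s : Finset T) t, ∑ x ∈ s with σ x = t, ‖w x‖ ^ 2 ≤ c ^ 2) (ξ : ℓ²(T, ℂ))
    (s : Finset T) : ∑ x ∈ s, ‖w x * ξ (σ x)‖ ^ (2 : ℝ≥0∞).toReal
      ≤ (c * ‖ξ‖) ^ (2 : ℝ≥0∞).toReal := by
  have h := lp.sum_rpow_le_norm_rpow (p := 2) (by norm_num) ξ (s.image σ)
  simp only [ENNReal.toReal_ofNat, Real.rpow_ofNat, norm_mul, mul_pow] at h ⊢
  rw [← Finset.sum_fiberwise_of_maps_to (fun x => Finset.mem_image_of_mem σ (s := s))]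
  calc _ ≤ ∑ t ∈ s.image σ, c ^ 2 * ‖ξ t‖ ^ 2 := by
        refine Finset.sum_le_sum fun t _ => ?_
        rw [Finset.sum_congr rfl fun x hx => by rw [(Finset.mem_filter.mp hx).2],
          ← Finset.sum_mul]
        gcongr
        exact hw s t
    _ ≤ _ := by
        rw [← Finset.mul_sum]
        gcongr

open Classical in
/-- The weighted composition operator `ξ ↦ w (ξ ∘ σ)` on `ℓ²(T)`. -/
def weightedComp (σ : T → T) (w : T → ℂ) (c : ℝ) (hc : 0 ≤ c)
    (hw : ∀ (s : Finset T) t, ∑ x ∈ s with σ x = t, ‖w x‖ ^ 2 ≤ c ^ 2) :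
    ℓ²(T, ℂ) →L[ℂ] ℓ²(T, ℂ) :=
  LinearMap.mkContinuous
    { toFun := fun ξ => ⟨fun x => w x * ξ (σ x), memℓp_gen' (sum_norm_weighted_comp_le hw ξ)⟩
      map_add' := fun ξ η => lp.ext (funext fun x => mul_add (w x) (ξ (σ x)) (η (σ x)))
      map_smul' := fun a ξ => lp.ext (funext fun x => mul_left_comm (w x) a (ξ (σ x))) } c
    fun ξ => lp.norm_le_of_forall_sum_le (by norm_num) (by positivity)
      (sum_norm_weighted_comp_le hw ξ)

end WeightedComposition

/-- The representation of `C₀(T)` on `ℓ²(T)` by multiplication operators. -/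
def mulRep (T : Type*) [TopologicalSpace T] :
    C₀(T, ℂ) →⋆ₙₐ[ℂ] (ℓ²(T, ℂ) →L[ℂ] ℓ²(T, ℂ)) where
  toFun f := weightedComp id f ‖f‖ (norm_nonneg f) fun s t => by
    classical
    have hf : ‖f t‖ ≤ ‖f‖ := by
      rw [← ZeroAtInftyContinuousMap.norm_toBCF_eq_norm]
      exact f.toBCF.norm_coe_le_norm t
    -- For `σ = id` the part of `s` over `t` has at most the one point `t`.
    refine (Finset.sum_le_sum_of_subset_of_nonneg (t := {t}) (fun x hx => ?_)
      fun _ _ _ => by positivity).trans ?_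
    · simpa using (Finset.mem_filter.mp hx).2
    · rw [Finset.sum_singleton]; gcongr
  map_smul' c f := by ext ξ x; exact mul_assoc c (f x) (ξ x)
  map_zero' := by ext ξ x; exact zero_mul (ξ x)
  map_add' f g := by ext ξ x; exact add_mul (f x) (g x) (ξ x)
  map_mul' f g := by ext ξ x; exact mul_assoc (f x) (g x) (ξ x)
  map_star' f := by
    rw [ContinuousLinearMap.star_eq_adjoint, ContinuousLinearMap.eq_adjoint_iff]
    intro ξ η
    rw [lp.inner_eq_tsum, lp.inner_eq_tsum]
    refine tsum_congr fun x => ?_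
    change η x * star (star (f x) * ξ x) = f x * η x * star (ξ x)
    rw [star_mul, star_star]
    ring

theorem mulRep_apply {T : Type*} [TopologicalSpace T] (f : C₀(T, ℂ)) (ξ : ℓ²(T, ℂ)) (x : T) :
    mulRep T f ξ x = f x * ξ x := rfl

theorem mulRep_injective (T : Type*) [TopologicalSpace T] : Function.Injective (mulRep T) := by
  classical
  rw [injective_iff_map_eq_zero]
  intro f hf
  ext t
  -- The coordinate at `t` of `f · δ_t` is `f(t)`.
  have h := congrArg (fun F : ℓ²(T, ℂ) →L[ℂ] ℓ²(T, ℂ) => F (lp.single 2 t 1) t) hf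
  simpa [mulRep_apply] using h

/-- Urysohn's lemma for `C₀(T)`. -/
theorem exists_C₀_one_zero {T : Type*} [TopologicalSpace T] [T2Space T] [LocallyCompactSpace T]
    {K F : Set T} (hK : IsCompact K) (hF : IsClosed F) (hd : Disjoint K F) :
    ∃ f : C₀(T, ℂ), (∀ x ∈ K, f x = 1) ∧ (∀ x ∈ F, f x = 0) ∧ ∀ x, ‖1 - f x‖ ≤ 1 := by
  obtain ⟨g, h1, h0, hc, hg⟩ := exists_continuous_one_zero_of_isCompact hK hF hd
  refine ⟨⟨⟨fun x => (g x : ℂ), by fun_prop⟩, ?_⟩, fun x hx => ?_, fun x hx => ?_, fun x => ?_⟩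
  · exact (hc.comp_left (g := ((↑) : ℝ → ℂ)) Complex.ofReal_zero).is_zero_at_infty
  · change (g x : ℂ) = 1
    rw [h1 hx]; simp
  · change (g x : ℂ) = 0
    rw [h0 hx]; simp
  · change ‖1 - (g x : ℂ)‖ ≤ 1
    rw [← Complex.ofReal_one, ← Complex.ofReal_sub, Complex.norm_real, Real.norm_eq_abs, abs_le]
    constructor <;> linarith [(hg x).1, (hg x).2]

/-! ### The covariant pair of a classical system -/

namespace ClassicalSystem

variable {T : Type u} [TopologicalSpace T] (D : ClassicalSystem T)

/-- The weight `|τ⁻¹(τ(x))|^(-1/2)`. -/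
def weight (x : T) : ℝ := (√(Nat.card (D.τ ⁻¹' {D.τ x})))⁻¹

theorem weight_eq {x t : T} (h : D.τ x = t) : D.weight x = (√(Nat.card (D.τ ⁻¹' {t})))⁻¹ := by
  rw [weight, h]

/-- The exponent `-1/2` is chosen for this: the weight occurs twice in `V* π(f) V`, and its square
is the normalising factor of `L`. -/
theorem weight_mul_self {x t : T} (h : D.τ x = t) :
    (D.weight x : ℂ) * D.weight x = (Nat.card (D.τ ⁻¹' {t}) : ℂ)⁻¹ := by
  rw [D.weight_eq h, ← Complex.ofReal_mul, ← mul_inv, Real.mul_self_sqrt (Nat.cast_nonneg _)]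
  push_cast
  rfl

theorem weight_ne_zero (x : T) : D.weight x ≠ 0 := by
  have : Finite (D.τ ⁻¹' {D.τ x}) := D.finite_fiber (D.τ x)
  have : Nonempty (D.τ ⁻¹' {D.τ x}) := ⟨⟨x, rfl⟩⟩
  have : 0 < Nat.card (D.τ ⁻¹' {D.τ x}) := Nat.card_pos
  rw [weight]
  positivity

/-- The operator `V` on `ℓ²(T)` with `(Vξ)(x) = |τ⁻¹(τ(x))|^(-1/2) ξ(τ(x))`. -/
def V : ℓ²(T, ℂ) →L[ℂ] ℓ²(T, ℂ) :=
  weightedComp D.τ (fun x => D.weight x) 1 zero_le_one fun s t => by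
    classical
    have hfin := D.finite_fiber t
    have h1 : ∀ x ∈ s.filter (D.τ · = t),
        ‖(D.weight x : ℂ)‖ ^ 2 = (hfin.toFinset.card : ℝ)⁻¹ := fun x hx => by
      rw [D.weight_eq (Finset.mem_filter.mp hx).2, Complex.norm_real, Real.norm_eq_abs, sq_abs,
        inv_pow, Real.sq_sqrt (Nat.cast_nonneg _), Nat.card_coe_set_eq,
        Set.ncard_eq_toFinset_card _ hfin]
    have h2 : (s.filter (D.τ · = t)).card ≤ hfin.toFinset.card :=
      Finset.card_le_card fun x hx => by simpa using (Finset.mem_filter.mp hx).2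
    rw [Finset.sum_congr rfl h1, Finset.sum_const, nsmul_eq_mul, one_pow, ← div_eq_mul_inv]
    -- The part of `s` over `t` contributes its cardinality divided by that of the whole fibre. Over
    -- an empty fibre this is `0 / 0 = 0`.
    exact div_le_one_of_le₀ (by exact_mod_cast h2) (Nat.cast_nonneg _)

theorem V_apply (ξ : ℓ²(T, ℂ)) (x : T) : D.V ξ x = D.weight x * ξ (D.τ x) := rfl

theorem V_mul_mulRep (f : C₀(T, ℂ)) : D.V * mulRep T f = mulRep T (D.α f) * D.V := by
  ext ξ x
  change D.weight x * (f (D.τ x) * ξ (D.τ x)) = f (D.τ x) * (D.weight x * ξ (D.τ x))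
  ring

variable [T2Space T] [LocallyCompactSpace T]

/-- Pairing `Vξ` multiplied by `f` with `Vη` gives a sum over `x` whose terms are `f(x)` times the
squared weight, `ξ(τ(x))` and the conjugate of `η(τ(x))`. On the fibre over `t` only `f(x)` varies,
so the fibre contributes `L(f)(t) ξ(t)` times the conjugate of `η(t)`. -/
theorem star_V_mul_mulRep_mul_V (f : C₀(T, ℂ)) :
    star D.V * mulRep T f * D.V = mulRep T (D.L f) := by
  refine ContinuousLinearMap.ext fun ξ => ext_inner_left ℂ fun η => ?_
  have hadj : inner ℂ η ((star D.V * mulRep T f * D.V) ξ)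
      = inner ℂ (D.V η) (mulRep T f (D.V ξ)) := by
    rw [mul_apply_eq_comp, mul_apply_eq_comp, ContinuousLinearMap.star_eq_adjoint]
    exact ContinuousLinearMap.adjoint_inner_right _ _ _
  have h := lp.hasSum_inner (𝕜 := ℂ) (G := fun _ : T => ℂ) (D.V η) (mulRep T f (D.V ξ))
  -- The inner product, a sum over `x`, is regrouped into a sum over `t` of sums over the fibres of
  -- `τ`.
  have h2 := HasSum.tsum_fiberwise (g := D.τ) h
  rw [hadj, ← h2.tsum_eq, lp.inner_eq_tsum (𝕜 := ℂ) (G := fun _ : T => ℂ)]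
  refine tsum_congr fun t => ?_
  have hfin := D.finite_fiber t
  have := hfin.fintype
  -- The fibre sums are finite. Over an empty fibre both sides are empty sums, in accordance with
  -- `L(f)(t) = 0`.
  rw [tsum_fintype, mulRep_apply, L_apply, ← finsum_set_coe_eq_finsum_mem,
    finsum_eq_sum_of_fintype, Finset.mul_sum, Finset.sum_mul, inner_sum]
  refine Finset.sum_congr rfl fun x _ => ?_
  have hx : D.τ x = t := x.2
  rw [mulRep_apply, V_apply, V_apply, hx, ← D.weight_mul_self hx]
  simp only [RCLike.inner_apply, map_mul, Complex.conj_ofReal]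
  ring

/-- The endomorphism `f ↦ f ∘ τ` is nondegenerate. -/
theorem exists_norm_sub_α_mul_lt (f : C₀(T, ℂ)) {ε : ℝ} (hε : 0 < ε) :
    ∃ g, ‖f - D.α g * f‖ < ε := by
  obtain ⟨K, hK, hKs⟩ := exists_compact f (half_pos hε)
  -- With `g = 1` on `τ(K)` the difference `f - α(g)f` vanishes on `K`; off `K` it is bounded by
  -- `‖f(x)‖ ≤ ε / 2`, because `‖1 - g‖ ≤ 1` everywhere.
  obtain ⟨g, h1, -, hg⟩ := exists_C₀_one_zero (hK.image D.isLocalHomeomorph.continuous)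
    isClosed_empty (Set.disjoint_empty _)
  refine ⟨g, lt_of_le_of_lt ?_ (half_lt_self hε)⟩
  rw [← ZeroAtInftyContinuousMap.norm_toBCF_eq_norm,
    BoundedContinuousFunction.norm_le (half_pos hε).le]
  intro x
  change ‖f x - g (D.τ x) * f x‖ ≤ ε / 2
  rw [show f x - g (D.τ x) * f x = (1 - g (D.τ x)) * f x by ring, norm_mul]
  by_cases hx : x ∈ K
  · rw [h1 _ ⟨x, hx, rfl⟩, sub_self, norm_zero, zero_mul]
    exact (half_pos hε).le
  · calc _ ≤ 1 * (ε / 2) := by gcongr; exacts [hg _, hKs x hx]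
      _ = _ := one_mul _

/-- The vectors `f · Vδ_t` span a dense subspace of `ℓ²(T)`. -/
theorem eq_zero_of_mul_mulRep_mul_V {b : ℓ²(T, ℂ) →L[ℂ] ℓ²(T, ℂ)}
    (hb : ∀ f, b * (mulRep T f * D.V) = 0) : b = 0 := by
  classical
  -- A bounded operator on `ℓ²(T)` is determined by its values on the vectors `δ_x`.
  refine lp.ext_continuousLinearMap (by norm_num) fun x => ?_
  ext1
  -- The rest of the fibre through `x` is finite, hence closed, so a function in `C₀(T)` can
  -- separate `x` from it.
  obtain ⟨f, h1, h0, -⟩ := exists_C₀_one_zero (K := {x}) (F := D.τ ⁻¹' {D.τ x} \ {x})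
    isCompact_singleton ((D.finite_fiber (D.τ x)).sdiff).isClosed Set.disjoint_sdiff_right
  have hsingle : ∀ z y : T, (lp.single 2 z 1 : ℓ²(T, ℂ)) y = if y = z then 1 else 0 := by
    intro z y
    split_ifs with h
    · rw [h]; exact lp.single_apply_self (E := fun _ : T => ℂ) 2 z 1
    · exact lp.single_apply_ne (E := fun _ : T => ℂ) 2 z 1 h
  -- `V δ_{τ(x)}` is supported on the fibre through `x`, and `f` removes all of it except the point
  -- `x`.
  have hx : mulRep T f (D.V (lp.single 2 (D.τ x) 1)) = (D.weight x : ℂ) • lp.single 2 x 1 := by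
    ext y
    rw [mulRep_apply, V_apply, lp.coeFn_smul, Pi.smul_apply, smul_eq_mul]
    rw [hsingle, hsingle]
    by_cases hy : y = x
    · rw [hy, h1 x rfl, if_pos rfl, if_pos rfl, one_mul]
    · rw [if_neg hy, mul_zero]
      by_cases hτ : D.τ y = D.τ x
      · rw [h0 y ⟨hτ, hy⟩, zero_mul]
      · rw [if_neg hτ, mul_zero, mul_zero]
  have h := congrArg (fun F : ℓ²(T, ℂ) →L[ℂ] ℓ²(T, ℂ) => F (lp.single 2 (D.τ x) 1)) (hb f)
  change b (mulRep T f (D.V (lp.single 2 (D.τ x) 1))) = 0 at h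
  rw [hx, map_smul, smul_eq_zero] at h
  exact h.resolve_left (by exact_mod_cast D.weight_ne_zero x)

end ClassicalSystem
end ExelCrossedProduct

end

theorem corollary4p5 {T : Type u} [TopologicalSpace T] [T2Space T] [LocallyCompactSpace T]
    (D : ExelCrossedProduct.ClassicalSystem T) :
    Function.Injective
        (D.transferSystem.crossedProductHom : C₀(T, ℂ) → D.transferSystem.CrossedProduct) ∧
      Function.Injective (D.transferSystem.bimodule.cuntzPimsnerHom :
        C₀(T, ℂ) → D.transferSystem.bimodule.CuntzPimsner) :=
  ExelCrossedProduct.TransferSystem.injective_of_pair (ExelCrossedProduct.mulRep T) D.V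
    (fun f _ hε => D.exists_norm_sub_α_mul_lt f hε) D.V_mul_mulRep D.star_V_mul_mulRep_mul_V
    (ExelCrossedProduct.mulRep_injective T) fun _ => D.eq_zero_of_mul_mulRep_mul_V
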